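/- **Conventions.** All spaces are real Banach spaces, and $\mathbb N=\{1,2,\dots\}$ when positions in a sequence are counted. For finitely supported vectors over a sequence, $x<y$ means that every element of the support of $x$ is smaller than every element of the support of $y$. A sequence $(y_i)$ is a block basis of $(x_i)$, written $(y_i)\prec(x_i)$, if $y_1<y_2<\cdots$ are nonzero finite linear combinations of the $x_i$. $[y_i]$ denotes the closed linear span of $(y_i)$. *Schreier families.* For every countable limit ordinal $\alpha$ fix an arbitrary sequence $\alpha_n\uparrow\alpha$. Let $\mathcal S_0$ consist of $\emptyset$ and the singletons, let $\mathcal S_1=\{F\subset\mathbb N \text{ finite}:\ |F|\le\min F\}\cup\{\emptyset\}$, let $\mathcal S_{\alpha+1}=\mathcal S_1[\mathcal S_\alpha]$ be the family of all unions $G_1\cup\cdots\cup G_k$ with $G_1<\cdots<G_k$ nonempty members of $\mathcal S_\alpha$ and $\{\min G_1,\dots,\min G_k\}\in\mathcal S_1$, and for limit $\alpha$ let $\mathcal S_\alpha=\{F:\ F\in\mathcal S_{\alpha_n}\text{ and } F\ge n\text{ for some }n\in\mathbb N\}$. *Asymptotic constants.* For a basic sequence $(x_i)$ and a norm $|\cdot|$,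 $\delta_\alpha((x_i),|\cdot|)$ is the supremum of all $\delta\ge0$ such that $|\sum_{i=1}^k y_i|\ge\delta\sum_{i=1}^k|y_i|$ for all finite block sequences $y_1<\cdots<y_k$ of $(x_i)$ with $\{\min\operatorname{supp}y_i: i\le k\}\in\mathcal S_\alpha$, supports being taken with respect to $(x_i)$. We write $\delta_\alpha(x_i)$ when $|\cdot|$ is the original norm. For $Y=[y_i]$ with basis $(y_i)$, $$\ddot\delta_\alpha(Y)=\sup_{|\cdot|}\ \sup_{(x_i)\prec(y_i)}\delta_\alpha((x_i),|\cdot|),$$ where $|\cdot|$ ranges over all equivalent norms on $Y$. *Stabilization.* A sequence $(y_i)$ $\Delta$-stabilizes $\gamma=(\gamma_\alpha)_{\alpha<\omega_1}\subset\mathbb R$ if there are $\varepsilon_n\downarrow0$ such that for every $\alpha<\omega_1$ there is $m$ such that for all $n\ge m$ and all $(z_i)\prec(y_i)_{i\ge n}$ we have $|\delta_\alpha(z_i)-\gamma_\alpha|<\varepsilon_n$. The spectrum $\Delta(X)$ is the set of all $\gamma$ that are $\Delta$-stabilized by some block basis of the basis of $X$. *Asymptotic $\ell_1$.* $X$ with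 a basis $(e_i)$ is asymptotic $\ell_1$ if there is $C>0$ such that $\|\sum_{i=1}^n x_i\|\ge C^{-1}\sum_{i=1}^n\|x_i\|$ for all $n$ and all blocks $x_1<\cdots<x_n$ of $(e_i)$ supported in $[n,\infty)$. *Bounded distortion.* $(Y,\|\cdot\|)$ is of $D$-bounded distortion if for every equivalent norm $|\cdot|$ on $Y$ and every closed infinite-dimensional subspace $Z\subseteq Y$ we have $\inf_W\sup\{|x|/|y|:\ x,y\in W,\ \|x\|=\|y\|=1\}\le D$, the infimum being over all closed infinite-dimensional subspaces $W$ of $Z$. **Theorem.** Let $X$ be an asymptotic $\ell_1$ space with respect to a Schauder basis $(e_i)$, let $\gamma\in\Delta(X)$, and let $(y_i)\prec(e_i)$ $\Delta$-stabilize $\gamma$. If $Y=[y_i]$ is of $D$-bounded distortion, then for all $\alpha<\omega_1$ and all integers $n,m\ge0$: a) $D^{-1}\,\ddot\delta_\alpha(Y)^n\le\gamma_{\alpha\cdot n}\le\ddot\delta_\alpha(Y)^n$; b) $\gamma_{\alpha\cdot n}\,\gamma_{\alpha\cdot m}\le\gamma_{\alpha\cdot(n+m)}\le D^2\,\gamma_{\alpha\cdot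 n}\,\gamma_{\alpha\cdot m}$. -/

import Mathlib

open Filter Topology
open scoped Ordinal

noncomputable section

/-! ### Schreier families

Sequences are indexed by `ℕ` starting at `0`, so the entry with index `k` is the `(k + 1)`-st entry
of the sequence.  Accordingly, a number `k` in a member of a family of finite sets stands for the
position `k + 1`, and "`min F ≥ |F|`" becomes "`|F| ≤ k + 1` for all `k ∈ F`". -/

/-- The first Schreier family: the finite sets `F` with `|F| ≤ min F` (positions counted from one),
together with the empty set. -/
def schreierOne : Set (Finset ℕ) :=
  {F | ∀ k ∈ F, F.card ≤ k + 1}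

/-- `𝓕[𝓖]`: all unions `G₁ ∪ ⋯ ∪ Gₙ` with `G₁ < ⋯ < Gₙ` nonempty members of `𝓖` such that
`{min G₁, …, min Gₙ} ∈ 𝓕`. -/
def famComp (𝓕 𝓖 : Set (Finset ℕ)) : Set (Finset ℕ) :=
  {E | ∃ (n : ℕ) (G : Fin n → Finset ℕ) (m : Fin n → ℕ),
    (∀ i, G i ∈ 𝓖) ∧ (∀ i, IsLeast (G i : Set ℕ) (m i)) ∧
    (∀ i j, i < j → ∀ a ∈ G i, ∀ b ∈ G j, a < b) ∧
    Finset.univ.image m ∈ 𝓕 ∧ E = Finset.univ.biUnion G}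

/-- A choice, for every countable limit ordinal `α`, of a sequence increasing strictly to `α`. -/
def IsLadderSystem (L : Ordinal.{0} → ℕ → Ordinal.{0}) : Prop :=
  ∀ α, Order.IsSuccLimit α → α < ω₁ →
    StrictMono (L α) ∧ (∀ n, L α n < α) ∧ ∀ β < α, ∃ n, β < L α n

/-- The Schreier family `𝓢_α` built with the choices `L` at limit ordinals: `𝓢_0` consists of the
singletons and the empty set, `𝓢_{α+1} = 𝓢_1[𝓢_α]`, and for a limit ordinal `α` a set `F` belongs
to `𝓢_α` if for some `n` it belongs to the family of the `n`-th term of the sequence chosen for `α`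
and `n ≤ F` (both `n` and the elements of `F` are shifted by one here). -/
def schreier (L : Ordinal.{0} → ℕ → Ordinal.{0}) (α : Ordinal.{0}) : Set (Finset ℕ) :=
  Ordinal.limitRecOn (motive := fun _ => Set (Finset ℕ)) α
    {F | F.card ≤ 1}
    (fun _ S => famComp schreierOne S)
    (fun β _ S => {F | ∃ (n : ℕ) (h : L β n < β), F ∈ S (L β n) h ∧ ∀ k ∈ F, n ≤ k})

theorem schreier_zero (L : Ordinal.{0} → ℕ → Ordinal.{0}) :
    schreier L 0 = {F | F.card ≤ 1} := by
  simp [schreier]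

theorem schreier_add_one (L : Ordinal.{0} → ℕ → Ordinal.{0}) (α : Ordinal.{0}) :
    schreier L (α + 1) = famComp schreierOne (schreier L α) := by
  simp [schreier]

theorem schreier_limit (L : Ordinal.{0} → ℕ → Ordinal.{0}) (α : Ordinal.{0})
    (hα : Order.IsSuccLimit α) :
    schreier L α = {F | ∃ n : ℕ, L α n < α ∧ F ∈ schreier L (L α n) ∧ ∀ k ∈ F, n ≤ k} := by
  rw [schreier, Ordinal.limitRecOn_limit _ _ _ _ hα]
  ext F
  exact ⟨fun ⟨n, h, hF, hk⟩ => ⟨n, h, hF, hk⟩, fun ⟨n, h, hF, hk⟩ => ⟨n, h, hF, hk⟩⟩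

/-! ### Block bases and asymptotic constants

The norms under consideration on a space are treated as seminorms `p : Seminorm ℝ X`; the norm of
`X` itself is `normSeminorm ℝ X`. -/

/-- The vector `∑ a_j x_j` with finitely supported coefficients `a`. -/
abbrev blockVec {X : Type*} [AddCommGroup X] [Module ℝ X] (x : ℕ → X) (a : ℕ →₀ ℝ) : X :=
  Finsupp.linearCombination ℝ x a

/-- The coefficient vectors `a i` are nonzero and their supports are successive:
`supp (a i) < supp (a j)` whenever `i < j`. -/
def IsSuccessive {ι : Type*} [LT ι] (a : ι → (ℕ →₀ ℝ)) : Prop :=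
  (∀ i, a i ≠ 0) ∧ ∀ i j, i < j → ∀ k ∈ (a i).support, ∀ l ∈ (a j).support, k < l

/-- `y ≺ x`: the sequence `y` is a block basis of the sequence `x`. -/
def IsBlockBasis {X : Type*} [AddCommGroup X] [Module ℝ X] (y x : ℕ → X) : Prop :=
  ∃ a : ℕ → (ℕ →₀ ℝ), IsSuccessive a ∧ ∀ i, y i = blockVec x (a i)

/-- The finite block sequence with coefficients `a` is `𝓕`-admissible: the set of the minima of the
supports belongs to `𝓕`. -/
def IsAdmissible (𝓕 : Set (Finset ℕ)) {k : ℕ} (a : Fin k → (ℕ →₀ ℝ)) : Prop :=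
  IsSuccessive a ∧ ∃ m : Fin k → ℕ,
    (∀ i, IsLeast ((a i).support : Set ℕ) (m i)) ∧ Finset.univ.image m ∈ 𝓕

/-- `δ_𝓕(x, p)`: the supremum of all `δ ≥ 0` such that `p (∑ y_i) ≥ δ ∑ p (y_i)` for every
finite block sequence `(y_i)` of `x` that is `𝓕`-admissible with respect to `x`. -/
def asympDelta {X : Type*} [AddCommGroup X] [Module ℝ X]
    (𝓕 : Set (Finset ℕ)) (p : Seminorm ℝ X) (x : ℕ → X) : ℝ :=
  sSup {δ : ℝ | 0 ≤ δ ∧ ∀ (k : ℕ) (a : Fin k → (ℕ →₀ ℝ)), IsAdmissible 𝓕 a →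
    δ * ∑ i, p (blockVec x (a i)) ≤ p (∑ i, blockVec x (a i))}

/-- `δ̇_𝓕(e, p)`: the supremum of `δ_𝓕(x, p)` over all block bases `x` of `e`. -/
def dotDelta {X : Type*} [AddCommGroup X] [Module ℝ X]
    (𝓕 : Set (Finset ℕ)) (p : Seminorm ℝ X) (e : ℕ → X) : ℝ :=
  sSup {r : ℝ | ∃ x : ℕ → X, IsBlockBasis x e ∧ r = asympDelta 𝓕 p x}

/-- `p` is an equivalent norm on the normed space `X`. -/
def IsEquivNorm {X : Type*} [NormedAddCommGroup X] [NormedSpace ℝ X]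
    (p : Seminorm ℝ X) : Prop :=
  ∃ c C : ℝ, 0 < c ∧ 0 < C ∧ ∀ x, c * ‖x‖ ≤ p x ∧ p x ≤ C * ‖x‖

/-- `δ̈_𝓕(X)` for a space `X` with basis `e`: the supremum of `δ̇_𝓕(e, p)` over all equivalent
norms `p` on `X`. -/
def ddotDelta {X : Type*} [NormedAddCommGroup X] [NormedSpace ℝ X]
    (𝓕 : Set (Finset ℕ)) (e : ℕ → X) : ℝ :=
  sSup {r : ℝ | ∃ p : Seminorm ℝ X, IsEquivNorm p ∧ r = dotDelta 𝓕 p e}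

/-- `X` is asymptotic `ℓ₁` with respect to `e`: for some `C`, all `n` and all successive blocks
`x_1 < ⋯ < x_n` of `e` supported from the `n`-th position on, `‖∑ x_i‖ ≥ (1 / C) ∑ ‖x_i‖`. -/
def IsAsymptoticEllOne {X : Type*} [NormedAddCommGroup X] [NormedSpace ℝ X]
    (e : ℕ → X) : Prop :=
  ∃ C : ℝ, 0 < C ∧ ∀ (n : ℕ) (a : Fin n → (ℕ →₀ ℝ)), IsSuccessive a →
    (∀ i, ∀ k ∈ (a i).support, n ≤ k + 1) →
    (1 / C) * ∑ i, ‖blockVec e (a i)‖ ≤ ‖∑ i, blockVec e (a i)‖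

/-- `y` `Δ`-stabilizes `γ = (γ_α)_{α < ω₁}` (only the values of `γ` below `ω₁` matter): there are
`ε_n ↓ 0` such that for every `α < ω₁`, for all large `n` and every block basis `z` of the tail
of `y` starting at `n`, `|δ_α(z) - γ_α| < ε_n`. -/
def DeltaStabilizes {X : Type*} [NormedAddCommGroup X] [NormedSpace ℝ X]
    (L : Ordinal.{0} → ℕ → Ordinal.{0}) (y : ℕ → X) (γ : Ordinal.{0} → ℝ) : Prop :=
  ∃ ε : ℕ → ℝ, Antitone ε ∧ Tendsto ε atTop (𝓝 0) ∧
    ∀ α < ω₁, ∃ m : ℕ, ∀ n ≥ m, ∀ z : ℕ → X, IsBlockBasis z (fun i => y (n + i)) →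
      |asympDelta (schreier L α) (normSeminorm ℝ X) z - γ α| < ε n

/-! ### Distortion -/

/-- `d(Y, p)`: the infimum, over all closed infinite-dimensional subspaces `Z` of `Y`, of
`sup {p x / p y : x, y ∈ Z, ‖x‖ = ‖y‖ = 1}`. -/
def distortion {X : Type*} [NormedAddCommGroup X] [NormedSpace ℝ X]
    (p : Seminorm ℝ X) (Y : Submodule ℝ X) : ℝ :=
  sInf {r : ℝ | ∃ Z : Submodule ℝ X, Z ≤ Y ∧ IsClosed (Z : Set X) ∧ ¬ FiniteDimensional ℝ Z ∧
    r = sSup {t : ℝ | ∃ x ∈ Z, ∃ y ∈ Z, ‖x‖ = 1 ∧ ‖y‖ = 1 ∧ t = p x / p y}}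

/-- `X` is of `D`-bounded distortion: `d(Y, p) ≤ D` for every equivalent norm `p` on `X` and every
closed infinite-dimensional subspace `Y` of `X`. -/
def IsOfBoundedDistortion (D : ℝ) (X : Type*) [NormedAddCommGroup X] [NormedSpace ℝ X] : Prop :=
  ∀ p : Seminorm ℝ X, IsEquivNorm p → ∀ Y : Submodule ℝ X, IsClosed (Y : Set X) →
    ¬ FiniteDimensional ℝ Y → distortion p Y ≤ D

/-! ### The closed span of a sequence -/

/-- `[y_i]`: the closed linear span of the sequence `y`. -/
def closedSpan {X : Type*} [NormedAddCommGroup X] [NormedSpace ℝ X] (y : ℕ → X) :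
    Submodule ℝ X :=
  (Submodule.span ℝ (Set.range y)).topologicalClosure

/-- The sequence `y` regarded as a sequence in the space `[y_i]`. -/
def inClosedSpan {X : Type*} [NormedAddCommGroup X] [NormedSpace ℝ X] (y : ℕ → X) :
    ℕ → closedSpan y :=
  fun i => ⟨y i, Submodule.le_topologicalClosure _ (Submodule.subset_span (Set.mem_range_self i))⟩

end

/-! Write d for δ̈_α(Y). Part a) is a power law: up to the factor D, the constant of order α·n is
the n-th power of d. It comes from comparing 𝓢_{α·n} with the n-fold composition of 𝓢_α. Neither
𝓢_{α+β} nor 𝓢_β[𝓢_α] need contain the other, as the ladders at limits are arbitrary, but a strictly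
increasing map of ℕ carries each into the other (`exists_image_famComp_schreier_subset`,
`exists_image_schreier_add_subset`). Such a map amounts to passing to a subsequence, which is
harmless because γ is the same for all block bases. Lower ℓ₁ estimates multiply under composition of
families, whence γ_α γ_β ≤ γ_{α+β} (`mul_le_add`).

Lower bound in a): if an equivalent norm p has 𝓢_α-constant δ on a block basis, then it has constant
δ^n for the n-fold composition, hence for 𝓢_{α·n} on a subsequence. Bounded distortion yields a
further block basis on which p and the norm are proportional up to a factor D' close to D
(`exists_isBlockBasis`). There the original norm has constant at least δ^n/D', which cannot exceed
γ_{α·n} (`asympDelta_pow_le`).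

Upper bound in a): for 0 < δ < γ_{α·n}, the lower estimate bounds all sums ∑ ‖P_I v‖ over disjoint
intervals I whose left ends form a member of the n-fold composition of 𝓢_α. Let q_k be the supremum
of these sums at depth k, with q_0 the norm. Then ∑_{k<n} θ^k q_k is an equivalent norm, and since ∑
q_k(y_i) ≤ q_{k+1}(∑ y_i) for 𝓢_α-admissible blocks, its 𝓢_α-constant is at least θ when θ^n =
δ/(K(1+K)), where K bounds the basis projections (`exists_isEquivNorm_hasLowerEstimate`). So γ_{α·n}
≤ K(1+K) d^n. Applying this to α·nj and using γ_{α·n}^j ≤ γ_{α·nj} removes the constant as j grows.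

The second half of b) is a) for n + m, n and m, since d^{n+m} = d^n d^m. -/

/-! ### Regular families of finite sets -/

/-- A family of finite sets of natural numbers is regular here if it is hereditary, spreading, and
contains the empty set and all singletons. -/
structure IsRegularFamily (𝓕 : Set (Finset ℕ)) : Prop where
  hereditary : ∀ F ∈ 𝓕, ∀ E ⊆ F, E ∈ 𝓕
  spreading : ∀ F ∈ 𝓕, ∀ h : ℕ → ℕ, StrictMonoOn h F → (∀ x ∈ F, x ≤ h x) → F.image h ∈ 𝓕
  of_card_le_one : ∀ F : Finset ℕ, F.card ≤ 1 → F ∈ 𝓕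

/-- A decomposition into successive pieces is encoded by the function sending each point to the
minimum of its piece; the pieces are its fibres. Together with the converse below, this replaces
indexed unions by monotone labels, which restrict and compose easily. -/
theorem exists_label_of_mem_famComp {𝓕 𝓖 : Set (Finset ℕ)} {E : Finset ℕ}
    (hE : E ∈ famComp 𝓕 𝓖) :
    ∃ φ : ℕ → ℕ, (∀ x ∈ E, φ x ∈ E) ∧ (∀ x ∈ E, φ x ≤ x) ∧ (∀ x ∈ E, φ (φ x) = φ x) ∧
      MonotoneOn φ E ∧ E.image φ ∈ 𝓕 ∧ ∀ c ∈ E.image φ, E.filter (φ · = c) ∈ 𝓖 := by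
  obtain ⟨n, G, m, hG, hm, hlt, hF, rfl⟩ := hE
  classical
  have huniq : ∀ i j x, x ∈ G i → x ∈ G j → i = j := by
    intro i j x hi hj
    rcases lt_trichotomy i j with h | h | h
    · exact absurd (hlt i j h x hi x hj) (lt_irrefl _)
    · exact h
    · exact absurd (hlt j i h x hj x hi) (lt_irrefl _)
  have hmG : ∀ i, m i ∈ G i := fun i => (hm i).1
  have hmle : ∀ i, ∀ x ∈ G i, m i ≤ x := fun i x hx => (hm i).2 hx
  let φ : ℕ → ℕ := fun x => if h : ∃ i, x ∈ G i then m h.choose else 0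
  have hφ : ∀ i, ∀ x ∈ G i, φ x = m i := by
    intro i x hx
    have h : ∃ i, x ∈ G i := ⟨i, hx⟩
    simp only [φ, dif_pos h]
    rw [huniq _ _ _ h.choose_spec hx]
  have hmem : ∀ x, x ∈ Finset.univ.biUnion G ↔ ∃ i, x ∈ G i := by simp
  have himage : (Finset.univ.biUnion G).image φ = Finset.univ.image m := by
    ext c
    simp only [Finset.mem_image, hmem, Finset.mem_univ, true_and]
    constructor
    · rintro ⟨x, ⟨i, hi⟩, rfl⟩
      exact ⟨i, (hφ i x hi).symm⟩
    · rintro ⟨i, rfl⟩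
      exact ⟨m i, ⟨i, hmG i⟩, hφ i _ (hmG i)⟩
  refine ⟨φ, ?_, ?_, ?_, ?_, himage ▸ hF, ?_⟩
  · intro x hx
    obtain ⟨i, hi⟩ := (hmem x).1 hx
    exact (hmem _).2 ⟨i, by rw [hφ i x hi]; exact hmG i⟩
  · intro x hx
    obtain ⟨i, hi⟩ := (hmem x).1 hx
    rw [hφ i x hi]
    exact hmle i x hi
  · intro x hx
    obtain ⟨i, hi⟩ := (hmem x).1 hx
    rw [hφ i x hi, hφ i _ (hmG i)]
  · intro x hx y hy hxy
    obtain ⟨i, hi⟩ := (hmem x).1 hx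
    obtain ⟨j, hj⟩ := (hmem y).1 hy
    rw [hφ i x hi, hφ j y hj]
    rcases lt_trichotomy i j with h | h | h
    · exact (hlt i j h _ (hmG i) _ (hmG j)).le
    · rw [h]
    · exact absurd (hlt j i h y hj x hi) (by omega)
  · intro c hc
    rw [himage] at hc
    obtain ⟨i, -, rfl⟩ := Finset.mem_image.1 hc
    convert hG i using 1
    ext x
    simp only [Finset.mem_filter, hmem]
    constructor
    · rintro ⟨⟨j, hj⟩, h⟩
      rw [hφ j x hj] at h
      rwa [huniq i j (m j) (h ▸ hmG i) (hmG j)]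
    · exact fun hx => ⟨⟨i, hx⟩, hφ i x hx⟩

/-- The labels need not be minima of the fibres, nor belong to `E`: they lie to the left of the true
minima, and spreading of `𝓕` moves them there. -/
theorem mem_famComp_of_label {𝓕 𝓖 : Set (Finset ℕ)} (h𝓕 : IsRegularFamily 𝓕) {E : Finset ℕ}
    (φ : ℕ → ℕ) (hle : ∀ x ∈ E, φ x ≤ x) (hmono : MonotoneOn φ E) (hF : E.image φ ∈ 𝓕)
    (hG : ∀ c ∈ E.image φ, E.filter (φ · = c) ∈ 𝓖) : E ∈ famComp 𝓕 𝓖 := by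
  classical
  set C := E.image φ with hC
  have hne : ∀ c ∈ C, (E.filter (φ · = c)).Nonempty := by
    intro c hc
    obtain ⟨x, hx, rfl⟩ := Finset.mem_image.1 hc
    exact ⟨x, by simp [hx]⟩
  let h : ℕ → ℕ := fun c => if hc : (E.filter (φ · = c)).Nonempty then
    (E.filter (φ · = c)).min' hc else 0
  have hleast : ∀ c ∈ C, IsLeast (E.filter (φ · = c) : Set ℕ) (h c) := by
    intro c hc
    simp only [h, dif_pos (hne c hc)]
    exact Finset.isLeast_min' _ _
  have hh : ∀ c ∈ C, h c ∈ E ∧ φ (h c) = c := fun c hc => by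
    simpa using (hleast c hc).1
  have hlt : ∀ x ∈ E, ∀ y ∈ E, φ x < φ y → x < y := by
    intro x hx y hy hxy
    by_contra hcon
    exact absurd (hmono hy hx (not_lt.1 hcon)) (not_le.2 hxy)
  have hhmono : StrictMonoOn h C := by
    intro c hc d hd hcd
    have h1 := hh c hc
    have h2 := hh d hd
    exact hlt _ h1.1 _ h2.1 (by rwa [h1.2, h2.2])
  have hhle : ∀ c ∈ C, c ≤ h c := by
    intro c hc
    have h1 := hh c hc
    calc c = φ (h c) := h1.2.symm
      _ ≤ h c := hle _ h1.1
  let o := C.orderEmbOfFin rfl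
  have ho : ∀ i, o i ∈ C := fun i => Finset.orderEmbOfFin_mem _ _ _
  refine ⟨C.card, fun i => E.filter (φ · = o i), fun i => h (o i), fun i => hG _ (ho i),
    fun i => hleast _ (ho i), ?_, ?_, ?_⟩
  · intro i j hij a ha b hb
    simp only [Finset.mem_filter] at ha hb
    exact hlt a ha.1 b hb.1 (by rw [ha.2, hb.2]; exact o.strictMono hij)
  · have : Finset.univ.image (fun i => h (o i)) = C.image h := by
      exact Finset.image_image.symm.trans
        (congrArg (Finset.image h) (Finset.image_orderEmbOfFin_univ C rfl))
    rw [this]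
    exact h𝓕.spreading _ hF h hhmono hhle
  · ext x
    simp only [Finset.mem_biUnion, Finset.mem_filter, Finset.mem_univ, true_and]
    constructor
    · intro hx
      have : φ x ∈ Set.range o := by
        rw [Finset.range_orderEmbOfFin]
        exact Finset.mem_image_of_mem _ hx
      obtain ⟨i, hi⟩ := this
      exact ⟨i, hx, hi.symm⟩
    · rintro ⟨i, hx, -⟩
      exact hx

theorem IsRegularFamily.famComp {𝓕 𝓖 : Set (Finset ℕ)} (h𝓕 : IsRegularFamily 𝓕)
    (h𝓖 : IsRegularFamily 𝓖) : IsRegularFamily (famComp 𝓕 𝓖) where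
  hereditary := by
    intro F hF E hEF
    obtain ⟨φ, -, h2, -, h4, h5, h6⟩ := exists_label_of_mem_famComp hF
    refine mem_famComp_of_label h𝓕 φ (fun x hx => h2 x (hEF hx)) (h4.mono (by exact_mod_cast hEF))
      (h𝓕.hereditary _ h5 _ (Finset.image_subset_image hEF)) fun c hc =>
      h𝓖.hereditary _ (h6 c (Finset.image_subset_image hEF hc)) _ (Finset.filter_subset_filter _ hEF)
  spreading := by
    intro F hF h hmono hle
    obtain ⟨φ, -, h2, -, h4, h5, h6⟩ := exists_label_of_mem_famComp hF
    have hinj : Set.InjOn h F := hmono.injOn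
    let g := Function.invFunOn h (F : Set ℕ)
    have hg : ∀ x ∈ F, g (h x) = x := fun x hx => hinj.leftInvOn_invFunOn hx
    have himage : (F.image h).image (fun x => φ (g x)) = F.image φ := by
      rw [Finset.image_image]
      refine Finset.image_congr fun x hx => ?_
      simp only [Function.comp_apply]
      rw [hg x hx]
    refine mem_famComp_of_label h𝓕 (fun x => φ (g x)) ?_ ?_ (himage ▸ h5) ?_
    · intro y hy
      obtain ⟨x, hx, rfl⟩ := Finset.mem_image.1 hy
      rw [hg x hx]
      exact (h2 x hx).trans (hle x hx)
    · intro y hy y' hy' hyy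
      obtain ⟨x, hx, rfl⟩ := Finset.mem_image.1 (Finset.mem_coe.1 hy)
      obtain ⟨x', hx', rfl⟩ := Finset.mem_image.1 (Finset.mem_coe.1 hy')
      simp only [hg x hx, hg x' hx']
      exact h4 hx hx' ((hmono.le_iff_le hx hx').1 hyy)
    · intro c hc
      rw [himage] at hc
      convert h𝓖.spreading _ (h6 c hc) h (hmono.mono
        (by exact_mod_cast Finset.filter_subset _ _)) (fun x hx => hle x
        (Finset.mem_filter.1 hx).1) using 1
      ext y
      simp only [Finset.mem_filter, Finset.mem_image]
      constructor
      · rintro ⟨⟨x, hx, rfl⟩, hy⟩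
        exact ⟨x, ⟨hx, by rwa [hg x hx] at hy⟩, rfl⟩
      · rintro ⟨x, ⟨hx, hc⟩, rfl⟩
        exact ⟨⟨x, hx, rfl⟩, by rwa [hg x hx]⟩
  of_card_le_one := by
    intro F hF
    refine mem_famComp_of_label h𝓕 id (fun _ _ => le_rfl) (monotone_id.monotoneOn _)
      (h𝓕.of_card_le_one _ (Finset.card_image_le.trans hF)) fun c _ =>
      h𝓖.of_card_le_one _ ((Finset.card_filter_le _ _).trans hF)

theorem isRegularFamily_schreierOne : IsRegularFamily schreierOne where
  hereditary F hF E hEF k hk := (Finset.card_le_card hEF).trans (hF k (hEF hk))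
  spreading F hF h _ hle k hk := by
    obtain ⟨x, hx, rfl⟩ := Finset.mem_image.1 hk
    have := hF x hx
    have := hle x hx
    exact Finset.card_image_le.trans (by omega)
  of_card_le_one F hF k _ := hF.trans (by omega)

theorem isRegularFamily_card_le_one : IsRegularFamily {F : Finset ℕ | F.card ≤ 1} where
  hereditary _ hF _ hEF := (Finset.card_le_card hEF).trans hF
  spreading _ hF _ _ _ := Finset.card_image_le.trans hF
  of_card_le_one _ hF := hF

theorem isRegularFamily_schreier {L : Ordinal.{0} → ℕ → Ordinal.{0}} (hL : IsLadderSystem L)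
    (α : Ordinal.{0}) (hα : α < ω₁) : IsRegularFamily (schreier L α) := by
  induction α using Ordinal.limitRecOn with
  | zero => rw [schreier_zero]; exact isRegularFamily_card_le_one
  | add_one α ih =>
    rw [schreier_add_one]
    exact isRegularFamily_schreierOne.famComp (ih ((Order.lt_add_one_iff.2 le_rfl).trans hα))
  | limit α hlim ih =>
    rw [schreier_limit L α hlim]
    refine ⟨?_, ?_, ?_⟩
    · rintro F ⟨n, hn, hF, hk⟩ E hEF
      exact ⟨n, hn, (ih _ hn (hn.trans hα)).hereditary F hF E hEF, fun k hkE => hk k (hEF hkE)⟩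
    · rintro F ⟨n, hn, hF, hk⟩ h hmono hle
      refine ⟨n, hn, (ih _ hn (hn.trans hα)).spreading F hF h hmono hle, fun k hkE => ?_⟩
      obtain ⟨x, hx, rfl⟩ := Finset.mem_image.1 hkE
      exact (hk x hx).trans (hle x hx)
    · intro F hF
      have hn := (hL α hlim hα).2.1 0
      exact ⟨0, hn, (ih _ hn (hn.trans hα)).of_card_le_one F hF, fun k _ => k.zero_le⟩

theorem subset_famComp {𝓕 𝓖 : Set (Finset ℕ)} (h𝓕 : IsRegularFamily 𝓕)
    (h𝓖 : IsRegularFamily 𝓖) : 𝓖 ⊆ famComp 𝓕 𝓖 := by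
  intro F hF
  -- A constant label makes all of `F` one piece.
  refine mem_famComp_of_label h𝓕 (fun _ => 0) (fun x _ => x.zero_le) (monotone_const.monotoneOn _)
    (h𝓕.of_card_le_one _ (Finset.card_le_one.2 ?_))
    fun c _ => h𝓖.hereditary _ hF _ (Finset.filter_subset _ _)
  simp only [Finset.mem_image]
  rintro a ⟨_, _, rfl⟩ b ⟨_, _, rfl⟩
  rfl

theorem famComp_assoc {𝓕 𝓖 𝓗 : Set (Finset ℕ)} (h𝓕 : IsRegularFamily 𝓕)
    (h𝓖 : IsRegularFamily 𝓖) :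
    famComp (famComp 𝓕 𝓖) 𝓗 = famComp 𝓕 (famComp 𝓖 𝓗) := by
  ext E
  constructor
  · intro hE
    obtain ⟨ψ, a1, a2, a3, a4, a5, a6⟩ := exists_label_of_mem_famComp hE
    obtain ⟨φ, b1, b2, b3, b4, b5, b6⟩ := exists_label_of_mem_famComp a5
    have hψ : ∀ x ∈ E, ψ x ∈ E.image ψ := fun x hx => Finset.mem_image_of_mem _ hx
    have himage : E.image (fun x => φ (ψ x)) = (E.image ψ).image φ := by
      rw [Finset.image_image]; rfl
    refine mem_famComp_of_label h𝓕 (fun x => φ (ψ x))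
      (fun x hx => (b2 _ (hψ x hx)).trans (a2 x hx)) ?_ (himage ▸ b5) ?_
    · intro x hx y hy hxy
      exact b4 (hψ x hx) (hψ y hy) (a4 hx hy hxy)
    · intro c hc
      rw [himage] at hc
      have hsub : E.filter (fun x => φ (ψ x) = c) ⊆ E := Finset.filter_subset _ _
      refine mem_famComp_of_label h𝓖 ψ (fun x hx => a2 x (hsub hx))
        (a4.mono (by exact_mod_cast hsub)) ?_ ?_
      · convert b6 c hc using 1
        ext d
        simp only [Finset.mem_image, Finset.mem_filter]
        constructor
        · rintro ⟨x, ⟨hx, h⟩, rfl⟩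
          exact ⟨⟨x, hx, rfl⟩, h⟩
        · rintro ⟨⟨x, hx, rfl⟩, h⟩
          exact ⟨x, ⟨hx, h⟩, rfl⟩
      · intro d hd
        obtain ⟨x, hx, rfl⟩ := Finset.mem_image.1 hd
        convert a6 (ψ x) (hψ x (hsub hx)) using 1
        ext z
        simp only [Finset.mem_filter] at hx ⊢
        constructor
        · exact fun h => ⟨h.1.1, h.2⟩
        · exact fun h => ⟨⟨h.1, by rw [h.2]; exact hx.2⟩, h.2⟩
  · intro hE
    obtain ⟨φ, a1, a2, a3, a4, a5, a6⟩ := exists_label_of_mem_famComp hE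
    have key : ∀ c : ℕ, ∃ ψ : ℕ → ℕ, c ∈ E.image φ →
        (∀ x ∈ E, φ x = c → ψ x ∈ E ∧ φ (ψ x) = c) ∧ (∀ x ∈ E, φ x = c → ψ x ≤ x) ∧
        MonotoneOn ψ (E.filter (φ · = c)) ∧ (E.filter (φ · = c)).image ψ ∈ 𝓖 ∧
        ∀ d ∈ (E.filter (φ · = c)).image ψ, (E.filter (φ · = c)).filter (ψ · = d) ∈ 𝓗 := by
      intro c
      by_cases hc : c ∈ E.image φ
      · obtain ⟨ψ, b1, b2, b3, b4, b5, b6⟩ := exists_label_of_mem_famComp (a6 c hc)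
        refine ⟨ψ, fun _ => ⟨?_, ?_, b4, b5, b6⟩⟩
        · intro x hx hxc
          simpa using b1 x (by simp [hx, hxc])
        · intro x hx hxc
          exact b2 x (by simp [hx, hxc])
      · exact ⟨id, fun h => absurd h hc⟩
    choose Ψ hΨ using key
    have hφ : ∀ x ∈ E, φ x ∈ E.image φ := fun x hx => Finset.mem_image_of_mem _ hx
    -- The labels chosen on the separate fibres of `φ` are glued. A label stays in the fibre of its
    -- point, which keeps `ψ` monotone across fibres.
    let ψ : ℕ → ℕ := fun x => Ψ (φ x) x
    have c1 : ∀ x ∈ E, ψ x ∈ E ∧ φ (ψ x) = φ x := fun x hx => (hΨ _ (hφ x hx)).1 x hx rfl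
    have c2 : ∀ x ∈ E, ψ x ≤ x := fun x hx => (hΨ _ (hφ x hx)).2.1 x hx rfl
    have himage : (E.image ψ).image φ = E.image φ := by
      rw [Finset.image_image]
      exact Finset.image_congr fun x hx => (c1 x hx).2
    refine mem_famComp_of_label (h𝓕.famComp h𝓖) ψ c2 ?_ ?_ ?_
    · intro x hx y hy hxy
      rcases (a4 hx hy hxy).lt_or_eq with h | h
      · by_contra hcon
        have := a4 (c1 y hy).1 (c1 x hx).1 (not_le.1 hcon).le
        rw [(c1 y hy).2, (c1 x hx).2] at this
        omega
      · have hm : MonotoneOn (Ψ (φ y)) (E.filter (φ · = φ y)) := (hΨ _ (hφ y hy)).2.2.1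
        have hx' : x ∈ (E.filter (φ · = φ y) : Set ℕ) := by
          rw [Finset.mem_coe, Finset.mem_filter]
          exact ⟨hx, h⟩
        have hy' : y ∈ (E.filter (φ · = φ y) : Set ℕ) := by
          rw [Finset.mem_coe, Finset.mem_filter]
          exact ⟨hy, rfl⟩
        have := hm hx' hy' hxy
        simp only [ψ]
        rwa [h]
    · refine mem_famComp_of_label h𝓕 φ ?_ ?_ (himage ▸ a5) ?_
      · intro d hd
        obtain ⟨x, hx, rfl⟩ := Finset.mem_image.1 hd
        exact a2 _ (c1 x hx).1
      · refine a4.mono ?_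
        intro d hd
        obtain ⟨x, hx, rfl⟩ := Finset.mem_image.1 (Finset.mem_coe.1 hd)
        exact (c1 x hx).1
      · intro c hc
        rw [himage] at hc
        convert (hΨ c hc).2.2.2.1 using 1
        ext d
        simp only [Finset.mem_image, Finset.mem_filter]
        constructor
        · rintro ⟨⟨x, hx, rfl⟩, h⟩
          rw [(c1 x hx).2] at h
          exact ⟨x, ⟨hx, h⟩, by simp only [ψ, h]⟩
        · rintro ⟨x, ⟨hx, rfl⟩, rfl⟩
          exact ⟨⟨x, hx, rfl⟩, (c1 x hx).2⟩
    · intro d hd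
      obtain ⟨x, hx, rfl⟩ := Finset.mem_image.1 hd
      convert (hΨ (φ x) (hφ x hx)).2.2.2.2 (ψ x)
        (Finset.mem_image.2 ⟨x, by simpa using hx, rfl⟩) using 1
      ext z
      simp only [Finset.mem_filter]
      constructor
      · rintro ⟨hz, h⟩
        have : φ z = φ x := by rw [← (c1 z hz).2, h, (c1 x hx).2]
        exact ⟨⟨hz, this⟩, by rw [← h, ← this]⟩
      · rintro ⟨⟨hz, h1⟩, h2⟩
        refine ⟨hz, ?_⟩
        simp only [ψ]
        rw [h1, h2]

/-! ### Comparison of Schreier families -/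

/-- At a limit, some ladder term exceeds γ, and discarding finitely many positions satisfies both
the inductive threshold and the index of that term. -/
theorem exists_schreier_subset {L : Ordinal.{0} → ℕ → Ordinal.{0}} (hL : IsLadderSystem L)
    {γ δ : Ordinal.{0}} (hγδ : γ < δ) (hδ : δ < ω₁) :
    ∃ m : ℕ, ∀ F ∈ schreier L γ, (∀ k ∈ F, m ≤ k) → F ∈ schreier L δ := by
  induction δ using Ordinal.limitRecOn with
  | zero => exact absurd hγδ not_lt_zero
  | add_one δ ih =>
    have hδ' : δ < ω₁ := (Order.lt_add_one_iff.2 le_rfl).trans hδ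
    have hsub : schreier L δ ⊆ schreier L (δ + 1) := by
      rw [schreier_add_one]
      exact subset_famComp isRegularFamily_schreierOne (isRegularFamily_schreier hL δ hδ')
    rcases (Order.lt_add_one_iff.1 hγδ).lt_or_eq with h | rfl
    · obtain ⟨m, hm⟩ := ih h hδ'
      exact ⟨m, fun F hF hk => hsub (hm F hF hk)⟩
    · exact ⟨0, fun F hF _ => hsub hF⟩
  | limit δ hlim ih =>
    obtain ⟨-, hlt, hcof⟩ := hL δ hlim hδ
    obtain ⟨n, hn⟩ := hcof γ hγδ
    obtain ⟨m, hm⟩ := ih (L δ n) (hlt n) hn ((hlt n).trans hδ)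
    refine ⟨max m n, fun F hF hk => ?_⟩
    rw [schreier_limit L δ hlim]
    exact ⟨n, hlt n, hm F hF fun k hkF => (le_max_left _ _).trans (hk k hkF),
      fun k hkF => (le_max_right _ _).trans (hk k hkF)⟩

/-- A strictly increasing function dominating countably many functions, the `n`-th one
from `n` on. -/
theorem exists_strictMono_dominating (g : ℕ → ℕ → ℕ) :
    ∃ f : ℕ → ℕ, StrictMono f ∧ ∀ n i, n ≤ i → g n i ≤ f i := by
  refine ⟨fun i => i + ∑ j ∈ Finset.range (i + 1), ∑ n ∈ Finset.range (j + 1), g n j, ?_, ?_⟩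
  · refine strictMono_nat_of_lt_succ fun i => ?_
    rw [Finset.sum_range_succ _ (i + 1)]
    omega
  · intro n i hni
    have h1 : g n i ≤ ∑ n ∈ Finset.range (i + 1), g n i :=
      Finset.single_le_sum (f := fun n => g n i) (fun _ _ => Nat.zero_le _)
        (Finset.mem_range.2 (by omega))
    have h2 : ∑ n ∈ Finset.range (i + 1), g n i ≤
        ∑ j ∈ Finset.range (i + 1), ∑ n ∈ Finset.range (j + 1), g n j :=
      Finset.single_le_sum (f := fun j => ∑ n ∈ Finset.range (j + 1), g n j)
        (fun _ _ => Nat.zero_le _) (Finset.mem_range.2 (by omega))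
    exact h1.trans (h2.trans (Nat.le_add_left _ _))

/-- This allows a map that works for one set to be replaced by any faster one, as the diagonal
arguments at limit ordinals require. -/
theorem IsRegularFamily.image_mem_of_le {𝓕 : Set (Finset ℕ)} (h𝓕 : IsRegularFamily 𝓕)
    {F : Finset ℕ} {g f : ℕ → ℕ} (hg : StrictMonoOn g F) (hf : StrictMonoOn f F)
    (hgf : ∀ x ∈ F, g x ≤ f x) (hF : F.image g ∈ 𝓕) : F.image f ∈ 𝓕 := by
  have hinv : ∀ x ∈ F, Function.invFunOn g (F : Set ℕ) (g x) = x := fun x hx =>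
    hg.injOn.leftInvOn_invFunOn hx
  have := h𝓕.spreading _ hF (fun y => f (Function.invFunOn g (F : Set ℕ) y)) ?_ ?_
  · convert this using 1
    rw [Finset.image_image]
    refine Finset.image_congr fun x hx => ?_
    simp only [Function.comp_apply]
    rw [hinv x hx]
  · intro y hy y' hy' hlt
    obtain ⟨x, hx, rfl⟩ := Finset.mem_image.1 (Finset.mem_coe.1 hy)
    obtain ⟨x', hx', rfl⟩ := Finset.mem_image.1 (Finset.mem_coe.1 hy')
    simp only [hinv x hx, hinv x' hx']
    exact hf hx hx' ((hg.lt_iff_lt hx hx').1 hlt)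
  · intro y hy
    obtain ⟨x, hx, rfl⟩ := Finset.mem_image.1 hy
    simp only [hinv x hx]
    exact hgf x hx

theorem image_mem_famComp {𝓕 𝓖 𝓖' : Set (Finset ℕ)} (h𝓕 : IsRegularFamily 𝓕) {f : ℕ → ℕ}
    (hf : StrictMono f) (h : ∀ F ∈ 𝓖, F.image f ∈ 𝓖') {E : Finset ℕ} (hE : E ∈ famComp 𝓕 𝓖) :
    E.image f ∈ famComp 𝓕 𝓖' := by
  obtain ⟨φ, a1, a2, a3, a4, a5, a6⟩ := exists_label_of_mem_famComp hE
  have hinv : ∀ x, Function.invFun f (f x) = x := Function.leftInverse_invFun hf.injective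
  have himage : (E.image f).image (fun y => φ (Function.invFun f y)) = E.image φ := by
    rw [Finset.image_image]
    exact Finset.image_congr fun x _ => by simp [hinv]
  refine mem_famComp_of_label h𝓕 (fun y => φ (Function.invFun f y)) ?_ ?_ (himage ▸ a5) ?_
  · intro y hy
    obtain ⟨x, hx, rfl⟩ := Finset.mem_image.1 hy
    rw [hinv]
    exact (a2 x hx).trans hf.le_apply
  · intro y hy y' hy' hlt
    obtain ⟨x, hx, rfl⟩ := Finset.mem_image.1 (Finset.mem_coe.1 hy)
    obtain ⟨x', hx', rfl⟩ := Finset.mem_image.1 (Finset.mem_coe.1 hy')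
    simp only [hinv]
    exact a4 hx hx' (hf.le_iff_le.1 hlt)
  · intro c hc
    rw [himage] at hc
    convert h _ (a6 c hc) using 1
    ext y
    simp only [Finset.mem_filter, Finset.mem_image]
    constructor
    · rintro ⟨⟨x, hx, rfl⟩, h⟩
      exact ⟨x, ⟨hx, by rwa [hinv] at h⟩, rfl⟩
    · rintro ⟨x, ⟨hx, h⟩, rfl⟩
      exact ⟨⟨x, hx, rfl⟩, by rwa [hinv]⟩

theorem famComp_singletons {𝓖 : Set (Finset ℕ)} (h𝓖 : IsRegularFamily 𝓖) :
    famComp {F | F.card ≤ 1} 𝓖 = 𝓖 := by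
  refine Set.Subset.antisymm ?_ (subset_famComp isRegularFamily_card_le_one h𝓖)
  intro E hE
  obtain ⟨φ, a1, a2, a3, a4, a5, a6⟩ := exists_label_of_mem_famComp hE
  rcases E.eq_empty_or_nonempty with rfl | ⟨x, hx⟩
  · exact h𝓖.of_card_le_one _ (by simp)
  · convert a6 (φ x) (Finset.mem_image_of_mem _ hx) using 1
    refine (Finset.filter_true_of_mem fun y hy => ?_).symm
    exact Finset.card_le_one.1 a5 _ (Finset.mem_image_of_mem _ hy) _ (Finset.mem_image_of_mem _ hx)

theorem famComp_inter_ge {𝓕 𝓕' 𝓖 : Set (Finset ℕ)} {m : ℕ}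
    (h : ∀ F ∈ 𝓕, (∀ k ∈ F, m ≤ k) → F ∈ 𝓕') {E : Finset ℕ} (hE : E ∈ famComp 𝓕 𝓖)
    (hm : ∀ k ∈ E, m ≤ k) : E ∈ famComp 𝓕' 𝓖 := by
  obtain ⟨n, G, μ, h1, h2, h3, h4, rfl⟩ := hE
  refine ⟨n, G, μ, h1, h2, h3, h _ h4 ?_, rfl⟩
  intro k hk
  obtain ⟨i, -, rfl⟩ := Finset.mem_image.1 hk
  exact hm _ (Finset.mem_biUnion.2 ⟨i, Finset.mem_univ _, (h2 i).1⟩)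

theorem mem_schreier_of_limit {L : Ordinal.{0} → ℕ → Ordinal.{0}} {α : Ordinal.{0}}
    (hα : Order.IsSuccLimit α) {n : ℕ} (hn : L α n < α) {F : Finset ℕ}
    (hF : F ∈ schreier L (L α n)) (hk : ∀ k ∈ F, n ≤ k) : F ∈ schreier L α := by
  rw [schreier_limit L α hα]
  exact ⟨n, hn, hF, hk⟩

theorem add_lt_omega_one {α β : Ordinal.{0}} (hα : α < ω₁) (hβ : β < ω₁) : α + β < ω₁ :=
  (Ordinal.isPrincipal_add_omega 1) hα hβ

/-- Successor steps are associativity of composition and keep the same map. At limits the ladder of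
α + β has nothing to do with that of β, so the inclusions for the individual ladder terms are
diagonalized. -/
theorem exists_image_famComp_schreier_subset {L : Ordinal.{0} → ℕ → Ordinal.{0}}
    (hL : IsLadderSystem L) {α β : Ordinal.{0}} (hα : α < ω₁) (hβ : β < ω₁) :
    ∃ f : ℕ → ℕ, StrictMono f ∧
      ∀ F ∈ famComp (schreier L β) (schreier L α), F.image f ∈ schreier L (α + β) := by
  induction β using Ordinal.limitRecOn with
  | zero =>
    refine ⟨id, strictMono_id, fun F hF => ?_⟩
    rw [schreier_zero, famComp_singletons (isRegularFamily_schreier hL α hα)] at hF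
    simpa using hF
  | add_one β ih =>
    have hβ' : β < ω₁ := (Order.lt_add_one_iff.2 le_rfl).trans hβ
    obtain ⟨f, hf, h⟩ := ih hβ'
    refine ⟨f, hf, fun F hF => ?_⟩
    rw [schreier_add_one, famComp_assoc isRegularFamily_schreierOne
      (isRegularFamily_schreier hL β hβ')] at hF
    rw [← add_assoc, schreier_add_one]
    exact image_mem_famComp isRegularFamily_schreierOne hf h hF
  | limit β hlim ih =>
    obtain ⟨-, hlt, -⟩ := hL β hlim hβ
    have hαβ := add_lt_omega_one hα hβ
    choose f hf h using fun n => ih (L β n) (hlt n) ((hlt n).trans hβ)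
    choose m hm using fun n => exists_schreier_subset hL
      (add_lt_add_right (hlt n) α) hαβ
    -- A set coming from the `n`-th ladder term starts at `n` or later, so a single `g` dominating
    -- `f n` and the threshold `m n` from `n` on serves every `n`.
    obtain ⟨g, hg, hdom⟩ := exists_strictMono_dominating fun n i => max (f n i) (m n)
    refine ⟨g, hg, fun F hF => ?_⟩
    obtain ⟨p, G, μ, h1, h2, h3, h4, rfl⟩ := hF
    rw [schreier_limit L β hlim] at h4
    obtain ⟨n, hn, h4, h5⟩ := h4
    have hge : ∀ k ∈ Finset.univ.biUnion G, n ≤ k := by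
      intro k hk
      obtain ⟨i, -, hi⟩ := Finset.mem_biUnion.1 hk
      exact (h5 (μ i) (Finset.mem_image_of_mem _ (Finset.mem_univ i))).trans ((h2 i).2 hi)
    have hF := h n _ ⟨p, G, μ, h1, h2, h3, h4, rfl⟩
    have hreg := isRegularFamily_schreier hL (α + L β n) (add_lt_omega_one hα ((hlt n).trans hβ))
    refine hm n _ (hreg.image_mem_of_le ((hf n).strictMonoOn _) (hg.strictMonoOn _) ?_ hF) ?_
    · exact fun x hx => (le_max_left _ _).trans (hdom n x (hge x hx))
    · intro k hk
      obtain ⟨x, hx, rfl⟩ := Finset.mem_image.1 hk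
      exact (le_max_right _ _).trans (hdom n x (hge x hx))

theorem exists_image_schreier_add_subset {L : Ordinal.{0} → ℕ → Ordinal.{0}}
    (hL : IsLadderSystem L) {α β : Ordinal.{0}} (hα : α < ω₁) (hβ : β < ω₁) :
    ∃ f : ℕ → ℕ, StrictMono f ∧
      ∀ F ∈ schreier L (α + β), F.image f ∈ famComp (schreier L β) (schreier L α) := by
  induction β using Ordinal.limitRecOn with
  | zero =>
    refine ⟨id, strictMono_id, fun F hF => ?_⟩
    rw [schreier_zero, famComp_singletons (isRegularFamily_schreier hL α hα)]
    simpa using hF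
  | add_one β ih =>
    have hβ' : β < ω₁ := (Order.lt_add_one_iff.2 le_rfl).trans hβ
    obtain ⟨f, hf, h⟩ := ih hβ'
    refine ⟨f, hf, fun F hF => ?_⟩
    rw [schreier_add_one, famComp_assoc isRegularFamily_schreierOne
      (isRegularFamily_schreier hL β hβ')]
    rw [← add_assoc, schreier_add_one] at hF
    exact image_mem_famComp isRegularFamily_schreierOne hf h hF
  | limit β hlim ih =>
    obtain ⟨-, hlt, hcof⟩ := hL β hlim hβ
    have hαβ := add_lt_omega_one hα hβ
    have hlim' : Order.IsSuccLimit (α + β) := Ordinal.isSuccLimit_add α hlim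
    obtain ⟨-, hlt', -⟩ := hL (α + β) hlim' hαβ
    -- The two ladders are interleaved: each term of the one at α + β lies below α plus some term of
    -- the one at β.
    have hidx : ∀ n, ∃ j, L (α + β) n < α + L β j := by
      intro n
      obtain ⟨b, hb, hb'⟩ := (Ordinal.lt_add_iff_of_isSuccLimit hlim).1 (hlt' n)
      obtain ⟨j, hj⟩ := hcof b hb
      exact ⟨j, hb'.trans (add_lt_add_right hj α)⟩
    choose j hj using hidx
    have hlt2 : ∀ n, α + L β (j n) < ω₁ := fun n => add_lt_omega_one hα ((hlt _).trans hβ)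
    choose f hf h using fun n => ih (L β n) (hlt n) ((hlt n).trans hβ)
    choose m hm using fun n => exists_schreier_subset hL (hj n) (hlt2 n)
    -- The shift by `m n` brings a set of the `n`-th family into the family of order α + `L β (j
    -- n)`, `f (j n)` decomposes it there, and the bound `j n` lets the minima of the pieces enter
    -- 𝓢_β through its limit clause.
    obtain ⟨g, hg, hdom⟩ :=
      exists_strictMono_dominating fun n i => max (f (j n) (i + m n)) (j n)
    refine ⟨g, hg, fun F hF => ?_⟩
    rw [schreier_limit L _ hlim'] at hF
    obtain ⟨n, hn, hF, hge⟩ := hF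
    have hshift : StrictMono fun i : ℕ => i + m n := fun a b hab => Nat.add_lt_add_right hab _
    have h1 : F.image (fun i => i + m n) ∈ schreier L (α + L β (j n)) := by
      refine hm n _ ((isRegularFamily_schreier hL _ (hn.trans hαβ)).spreading F hF _
        (hshift.strictMonoOn _) fun x _ => Nat.le_add_right _ _) ?_
      intro k hk
      obtain ⟨x, -, rfl⟩ := Finset.mem_image.1 hk
      exact Nat.le_add_left _ _
    have h2 := h (j n) _ h1
    rw [Finset.image_image] at h2
    have hreg := (isRegularFamily_schreier hL (L β (j n)) ((hlt _).trans hβ)).famComp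
      (isRegularFamily_schreier hL α hα)
    have h3 : F.image g ∈ _ := hreg.image_mem_of_le (((hf (j n)).comp hshift).strictMonoOn _)
      (hg.strictMonoOn _) (fun x hx => (le_max_left _ _).trans (hdom n x (hge x hx))) h2
    refine famComp_inter_ge (m := j n) (fun E hE hk => mem_schreier_of_limit hlim (hlt _) hE hk)
      h3 ?_
    intro k hk
    obtain ⟨x, hx, rfl⟩ := Finset.mem_image.1 hk
    exact (le_max_right _ _).trans (hdom n x (hge x hx))

/-! ### Iterated composition -/

/-- The `n`-fold composition `𝓕[𝓕[⋯]]`, starting with the singletons. -/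
def famPow (𝓕 : Set (Finset ℕ)) : ℕ → Set (Finset ℕ)
  | 0 => {F | F.card ≤ 1}
  | n + 1 => famComp 𝓕 (famPow 𝓕 n)

theorem IsRegularFamily.famPow {𝓕 : Set (Finset ℕ)} (h𝓕 : IsRegularFamily 𝓕) (n : ℕ) :
    IsRegularFamily (famPow 𝓕 n) := by
  induction n with
  | zero => exact isRegularFamily_card_le_one
  | succ n ih => exact h𝓕.famComp ih

theorem famPow_mono {𝓕 : Set (Finset ℕ)} (h𝓕 : IsRegularFamily 𝓕) : Monotone (famPow 𝓕) :=
  monotone_nat_of_le_succ fun n => subset_famComp h𝓕 (h𝓕.famPow n)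

theorem mul_natCast_lt_omega_one {α : Ordinal.{0}} (hα : α < ω₁) (n : ℕ) : α * n < ω₁ := by
  induction n with
  | zero => simpa using Ordinal.omega_pos 1
  | succ n ih =>
    rw [Nat.cast_succ, mul_add, mul_one]
    exact add_lt_omega_one ih hα

theorem exists_image_famPow_subset {L : Ordinal.{0} → ℕ → Ordinal.{0}} (hL : IsLadderSystem L)
    {α : Ordinal.{0}} (hα : α < ω₁) (n : ℕ) :
    ∃ f : ℕ → ℕ, StrictMono f ∧
      ∀ F ∈ famPow (schreier L α) n, F.image f ∈ schreier L (α * n) := by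
  induction n with
  | zero => exact ⟨id, strictMono_id, fun F hF => by simpa [schreier_zero, famPow] using hF⟩
  | succ n ih =>
    obtain ⟨f, hf, h⟩ := ih
    obtain ⟨g, hg, h'⟩ :=
      exists_image_famComp_schreier_subset hL (mul_natCast_lt_omega_one hα n) hα
    refine ⟨g ∘ f, hg.comp hf, fun F hF => ?_⟩
    rw [Nat.cast_succ, mul_add, mul_one, ← Finset.image_image]
    exact h' _ (image_mem_famComp (isRegularFamily_schreier hL α hα) hf h hF)

theorem exists_image_schreier_mul_subset {L : Ordinal.{0} → ℕ → Ordinal.{0}}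
    (hL : IsLadderSystem L) {α : Ordinal.{0}} (hα : α < ω₁) (n : ℕ) :
    ∃ f : ℕ → ℕ, StrictMono f ∧
      ∀ F ∈ schreier L (α * n), F.image f ∈ famPow (schreier L α) n := by
  induction n with
  | zero => exact ⟨id, strictMono_id, fun F hF => by simpa [schreier_zero, famPow] using hF⟩
  | succ n ih =>
    obtain ⟨f, hf, h⟩ := ih
    obtain ⟨g, hg, h'⟩ :=
      exists_image_schreier_add_subset hL (mul_natCast_lt_omega_one hα n) hα
    refine ⟨f ∘ g, hf.comp hg, fun F hF => ?_⟩
    rw [Nat.cast_succ, mul_add, mul_one] at hF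
    rw [← Finset.image_image]
    exact image_mem_famComp (isRegularFamily_schreier hL α hα) hf h (h' _ hF)

/-! ### Block sequences -/

theorem blockVec_linearCombination {X : Type*} [AddCommGroup X] [Module ℝ X] (x : ℕ → X)
    (a : ℕ → (ℕ →₀ ℝ)) (c : ℕ →₀ ℝ) :
    blockVec x (Finsupp.linearCombination ℝ a c) = blockVec (fun i => blockVec x (a i)) c := by
  simp [Finsupp.linearCombination_apply ℝ c, Finsupp.sum, map_sum]

theorem IsSuccessive.exists_strictMono {a : ℕ → (ℕ →₀ ℝ)} (ha : IsSuccessive a) :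
    ∃ μ : ℕ → ℕ, StrictMono μ ∧ (∀ i, μ i ∈ (a i).support) ∧
      ∀ i, ∀ k ∈ (a i).support, μ i ≤ k ∧ k < μ (i + 1) := by
  have hne : ∀ i, (a i).support.Nonempty := fun i => Finsupp.support_nonempty_iff.2 (ha.1 i)
  refine ⟨fun i => (a i).support.min' (hne i), strictMono_nat_of_lt_succ fun i => ?_,
    fun i => Finset.min'_mem _ _, fun i k hk => ⟨Finset.min'_le _ _ hk, ?_⟩⟩
  · exact ha.2 i (i + 1) (Nat.lt_succ_self i) _ (Finset.min'_mem _ _) _ (Finset.min'_mem _ _)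
  · exact ha.2 i (i + 1) (Nat.lt_succ_self i) _ hk _ (Finset.min'_mem _ _)

theorem exists_mem_support_of_mem_support_linearCombination {a : ℕ → (ℕ →₀ ℝ)} {c : ℕ →₀ ℝ}
    {k : ℕ} (hk : k ∈ (Finsupp.linearCombination ℝ a c).support) :
    ∃ i ∈ c.support, k ∈ (a i).support := by
  by_contra! hcon
  refine (Finsupp.mem_support_iff.1 hk) ?_
  rw [Finsupp.linearCombination_apply, Finsupp.sum, Finsupp.finsetSum_apply]
  refine Finset.sum_eq_zero fun i hi => ?_
  have := hcon i hi
  rw [Finsupp.notMem_support_iff] at this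
  simp [this]

theorem IsSuccessive.linearCombination {ι : Type*} [LT ι] {a : ℕ → (ℕ →₀ ℝ)}
    {c : ι → (ℕ →₀ ℝ)} (ha : IsSuccessive a) (hc : IsSuccessive c) :
    IsSuccessive fun i => Finsupp.linearCombination ℝ a (c i) := by
  obtain ⟨μ, hμ, hmem, hle⟩ := ha.exists_strictMono
  constructor
  · intro i h0
    obtain ⟨j, hj⟩ := Finsupp.support_nonempty_iff.2 (hc.1 i)
    -- Only `a j` is nonzero at its first support point `μ j`, so the coefficient there cannot
    -- cancel.
    have h1 : Finsupp.linearCombination ℝ a (c i) (μ j) = 0 := DFunLike.congr_fun h0 (μ j)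
    rw [Finsupp.linearCombination_apply, Finsupp.sum, Finsupp.finsetSum_apply,
      Finset.sum_eq_single j] at h1
    · have h2 := Finsupp.mem_support_iff.1 (hmem j)
      have h3 := Finsupp.mem_support_iff.1 hj
      simp [h2, h3] at h1
    · intro l _ hlj
      have : a l (μ j) = 0 := by
        by_contra hcon
        have hcon' := Finsupp.mem_support_iff.2 hcon
        rcases lt_or_gt_of_ne hlj with h | h
        · exact lt_irrefl _ (ha.2 l j h _ hcon' _ (hmem j))
        · exact lt_irrefl _ (ha.2 j l h _ (hmem j) _ hcon')
      simp [this]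
    · exact fun h => absurd hj h
  · intro i j hij k hk l hl
    obtain ⟨i', hi', hk'⟩ := exists_mem_support_of_mem_support_linearCombination hk
    obtain ⟨j', hj', hl'⟩ := exists_mem_support_of_mem_support_linearCombination hl
    exact ha.2 i' j' (hc.2 i j hij _ hi' _ hj') _ hk' _ hl'

theorem IsBlockBasis.trans {X : Type*} [AddCommGroup X] [Module ℝ X] {z x y : ℕ → X}
    (hzx : IsBlockBasis z x) (hxy : IsBlockBasis x y) : IsBlockBasis z y := by
  obtain ⟨c, hc, hz⟩ := hzx
  obtain ⟨a, ha, hx⟩ := hxy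
  refine ⟨_, ha.linearCombination hc, fun i => ?_⟩
  rw [blockVec_linearCombination, hz, funext hx]

theorem isSuccessive_single {f : ℕ → ℕ} (hf : StrictMono f) :
    IsSuccessive fun i => Finsupp.single (f i) (1 : ℝ) := by
  refine ⟨fun i => by simp, fun i j hij k hk l hl => ?_⟩
  rw [Finsupp.support_single _ one_ne_zero, Finset.mem_singleton] at hk hl
  subst hk hl
  exact hf hij

theorem isBlockBasis_comp {X : Type*} [AddCommGroup X] [Module ℝ X] (x : ℕ → X) {f : ℕ → ℕ}
    (hf : StrictMono f) : IsBlockBasis (fun i => x (f i)) x :=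
  ⟨_, isSuccessive_single hf, fun i => by simp⟩

theorem IsBlockBasis.refl {X : Type*} [AddCommGroup X] [Module ℝ X] (x : ℕ → X) :
    IsBlockBasis x x :=
  isBlockBasis_comp x strictMono_id

theorem strictMono_const_add (N : ℕ) : StrictMono fun i => N + i :=
  fun _ _ h => Nat.add_lt_add_left h N

/-- The block with index `i` is supported from position `i` on, so the blocks from `N` on only
involve the tail from `N`. -/
theorem IsBlockBasis.tail {X : Type*} [AddCommGroup X] [Module ℝ X] {z y : ℕ → X}
    (h : IsBlockBasis z y) (N : ℕ) :
    IsBlockBasis (fun i => z (N + i)) (fun i => y (N + i)) := by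
  obtain ⟨a, ha, hz⟩ := h
  obtain ⟨μ, hμ, -, hle⟩ := ha.exists_strictMono
  have hinj : Function.Injective fun i => N + i := (strictMono_const_add N).injective
  have hrange : ∀ i, ((a (N + i)).support : Set ℕ) ⊆ Set.range fun i => N + i := by
    intro i k hk
    have h1 := (hle _ k hk).1
    have h2 : N + i ≤ μ (N + i) := hμ.le_apply
    exact ⟨k - N, by simp only; omega⟩
  have hmap : ∀ i, Finsupp.mapDomain (fun i => N + i)
      ((a (N + i)).comapDomain (fun i => N + i) hinj.injOn) = a (N + i) := fun i =>
    Finsupp.mapDomain_comapDomain _ hinj _ (hrange i)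
  refine ⟨fun i => (a (N + i)).comapDomain (fun i => N + i) hinj.injOn, ⟨fun i h0 => ?_, ?_⟩, ?_⟩
  · have := hmap i
    rw [show Finsupp.comapDomain (fun i => N + i) (a (N + i)) hinj.injOn = 0 from h0,
      Finsupp.mapDomain_zero] at this
    exact ha.1 _ this.symm
  · intro i j hij k hk l hl
    rw [Finsupp.comapDomain_support, Finset.mem_preimage] at hk hl
    have := ha.2 (N + i) (N + j) (by omega) _ hk _ hl
    omega
  · intro i
    have := Finsupp.linearCombination_mapDomain ℝ (v' := y) (fun i => N + i)
      ((a (N + i)).comapDomain (fun i => N + i) hinj.injOn)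
    rw [hmap i] at this
    exact (hz _).trans this

/-! ### Lower `ℓ₁` estimates -/

/-- The coefficient vectors `b m`, `m ∈ s`, are supported in the successive intervals determined by
the elements of `s`. -/
def IsBlockFamily (s : Finset ℕ) (b : ℕ → (ℕ →₀ ℝ)) : Prop :=
  ∀ m ∈ s, ∀ k ∈ (b m).support, m ≤ k ∧ ∀ m' ∈ s, m < m' → k < m'

/-- The lower `ℓ₁` estimate with constant `δ` for all blocks of `x` whose supports start at the
members of a set in `𝓕`. -/
def HasLowerEstimate {X : Type*} [AddCommGroup X] [Module ℝ X]
    (𝓕 : Set (Finset ℕ)) (p : Seminorm ℝ X) (x : ℕ → X) (δ : ℝ) : Prop :=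
  ∀ s ∈ 𝓕, ∀ b : ℕ → (ℕ →₀ ℝ), IsBlockFamily s b →
    δ * ∑ m ∈ s, p (blockVec x (b m)) ≤ p (∑ m ∈ s, blockVec x (b m))

section

variable {X : Type*} [AddCommGroup X] [Module ℝ X] {𝓕 𝓖 : Set (Finset ℕ)} {p : Seminorm ℝ X}
  {x : ℕ → X} {δ : ℝ}

theorem HasLowerEstimate.of_le (h : HasLowerEstimate 𝓕 p x δ) {ε : ℝ} (hε : ε ≤ δ) :
    HasLowerEstimate 𝓕 p x ε := fun s hs b hb =>
  (mul_le_mul_of_nonneg_right hε (Finset.sum_nonneg fun _ _ => apply_nonneg _ _)).trans (h s hs b hb)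

theorem hasLowerEstimate_zero : HasLowerEstimate 𝓕 p x 0 := fun s _ b _ => by
  rw [zero_mul]
  exact apply_nonneg _ _

theorem HasLowerEstimate.of_isAdmissible (h : HasLowerEstimate 𝓕 p x δ) {k : ℕ}
    {a : Fin k → (ℕ →₀ ℝ)} (ha : IsAdmissible 𝓕 a) :
    δ * ∑ i, p (blockVec x (a i)) ≤ p (∑ i, blockVec x (a i)) := by
  obtain ⟨⟨-, hlt⟩, m, hm, hF⟩ := ha
  have hmono : StrictMono m := fun i j hij => hlt i j hij _ (hm i).1 _ (hm j).1
  have hb : ∀ i, Function.extend m a 0 (m i) = a i := fun i => hmono.injective.extend_apply _ _ _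
  have := h _ hF (Function.extend m a 0) ?_
  · rw [Finset.sum_image (hmono.injective.injOn), Finset.sum_image (hmono.injective.injOn)] at this
    simpa only [hb] using this
  · intro c hc k hk
    obtain ⟨i, -, rfl⟩ := Finset.mem_image.1 hc
    rw [hb] at hk
    refine ⟨(hm i).2 hk, fun m' hm' hlt' => ?_⟩
    obtain ⟨j, -, rfl⟩ := Finset.mem_image.1 hm'
    exact hlt i j (hmono.lt_iff_lt.1 hlt') _ hk _ (hm j).1

theorem sum_eq_sum_orderEmbOfFin {M : Type*} [AddCommMonoid M] {s t : Finset ℕ} (hts : t ⊆ s)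
    (g : ℕ → M) (h : ∀ m ∈ s, m ∉ t → g m = 0) :
    ∑ m ∈ s, g m = ∑ i, g (t.orderEmbOfFin rfl i) := by
  have h2 := Finset.sum_image (f := g) (s := Finset.univ) (g := t.orderEmbOfFin rfl)
    (t.orderEmbOfFin rfl).injective.injOn
  rw [Finset.image_orderEmbOfFin_univ] at h2
  rw [← Finset.sum_subset hts h, h2]

/-- In `HasLowerEstimate` a block may vanish or start after its marker. Zero blocks are dropped by
heredity, and the true minima are reached from the markers by spreading. -/
theorem hasLowerEstimate_of_forall_isAdmissible (h𝓕 : IsRegularFamily 𝓕)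
    (h : ∀ (k : ℕ) (a : Fin k → (ℕ →₀ ℝ)), IsAdmissible 𝓕 a →
      δ * ∑ i, p (blockVec x (a i)) ≤ p (∑ i, blockVec x (a i))) :
    HasLowerEstimate 𝓕 p x δ := by
  classical
  intro s hs b hb
  let t := s.filter fun m => b m ≠ 0
  have hts : t ⊆ s := Finset.filter_subset _ _
  have hne : ∀ m ∈ t, (b m).support.Nonempty := fun m hm =>
    Finsupp.support_nonempty_iff.2 (Finset.mem_filter.1 hm).2
  let μ : ℕ → ℕ := fun m => if h : (b m).support.Nonempty then (b m).support.min' h else 0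
  have hleast : ∀ m ∈ t, IsLeast ((b m).support : Set ℕ) (μ m) := by
    intro m hm
    simp only [μ, dif_pos (hne m hm)]
    exact Finset.isLeast_min' _ _
  have hμge : ∀ m ∈ t, m ≤ μ m := fun m hm => (hb m (hts hm) _ (hleast m hm).1).1
  have hsucc : ∀ m ∈ t, ∀ m' ∈ t, m < m' → ∀ k ∈ (b m).support, ∀ l ∈ (b m').support, k < l :=
    fun m hm m' hm' hlt k hk l hl =>
      ((hb m (hts hm) k hk).2 m' (hts hm') hlt).trans_le (hb m' (hts hm') l hl).1
  have hμ : StrictMonoOn μ t := fun m hm m' hm' hlt =>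
    hsucc m hm m' hm' hlt _ (hleast m hm).1 _ (hleast m' hm').1
  let o := t.orderEmbOfFin rfl
  have ho : ∀ i, o i ∈ t := fun i => Finset.orderEmbOfFin_mem _ _ _
  have himage : Finset.univ.image o = t := Finset.image_orderEmbOfFin_univ t rfl
  have hadm : IsAdmissible 𝓕 fun i => b (o i) := by
    refine ⟨⟨fun i => (Finset.mem_filter.1 (ho i)).2, fun i j hij =>
      hsucc _ (ho i) _ (ho j) (o.strictMono hij)⟩, fun i => μ (o i), fun i => hleast _ (ho i), ?_⟩
    have : Finset.univ.image (fun i => μ (o i)) = t.image μ :=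
      Finset.image_image.symm.trans (congrArg (Finset.image μ) himage)
    rw [this]
    exact h𝓕.spreading _ (h𝓕.hereditary _ hs _ hts) μ hμ hμge
  have h0 : ∀ m ∈ s, m ∉ t → b m = 0 := fun m hm hmt => by
    by_contra hcon
    exact hmt (Finset.mem_filter.2 ⟨hm, hcon⟩)
  have hsum1 := sum_eq_sum_orderEmbOfFin hts (fun m => p (blockVec x (b m)))
    fun m hm hmt => by simp [h0 m hm hmt]
  have hsum2 := sum_eq_sum_orderEmbOfFin hts (fun m => blockVec x (b m))
    fun m hm hmt => by simp [h0 m hm hmt]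
  rw [hsum1, hsum2]
  exact h _ _ hadm

theorem asympDelta_nonneg : 0 ≤ asympDelta 𝓕 p x :=
  Real.sSup_nonneg fun _ h => h.1

theorem isAdmissible_single (h𝓕 : IsRegularFamily 𝓕) (i : ℕ) :
    IsAdmissible 𝓕 fun _ : Fin 1 => Finsupp.single i (1 : ℝ) := by
  refine ⟨⟨fun _ => by simp, fun j k hjk => absurd hjk (by simp [Subsingleton.elim j k])⟩,
    fun _ => i, fun _ => ?_, h𝓕.of_card_le_one _ (Finset.card_image_le.trans (by simp))⟩
  rw [Finsupp.support_single _ one_ne_zero]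
  simp

theorem le_one_of_forall_isAdmissible (h𝓕 : IsRegularFamily 𝓕) {i : ℕ} (hi : 0 < p (x i))
    (h : ∀ (k : ℕ) (a : Fin k → (ℕ →₀ ℝ)), IsAdmissible 𝓕 a →
      δ * ∑ i, p (blockVec x (a i)) ≤ p (∑ i, blockVec x (a i))) : δ ≤ 1 := by
  have := h 1 _ (isAdmissible_single h𝓕 i)
  simp only [Finset.univ_unique, Finset.sum_singleton, blockVec,
    Finsupp.linearCombination_single, one_smul] at this
  nlinarith

theorem asympDelta_le_one (h𝓕 : IsRegularFamily 𝓕) {i : ℕ} (hi : 0 < p (x i)) :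
    asympDelta 𝓕 p x ≤ 1 :=
  Real.sSup_le (fun _ h => le_one_of_forall_isAdmissible h𝓕 hi h.2) zero_le_one

theorem HasLowerEstimate.le_asympDelta (h𝓕 : IsRegularFamily 𝓕) {i : ℕ} (hi : 0 < p (x i))
    (h0 : 0 ≤ δ) (h : HasLowerEstimate 𝓕 p x δ) : δ ≤ asympDelta 𝓕 p x :=
  le_csSup ⟨1, fun _ h => le_one_of_forall_isAdmissible h𝓕 hi h.2⟩
    ⟨h0, fun _ _ ha => h.of_isAdmissible ha⟩

/-- Each admissible sequence imposes a closed upper bound on δ, so the supremum is attained. -/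
theorem hasLowerEstimate_asympDelta (h𝓕 : IsRegularFamily 𝓕) :
    HasLowerEstimate 𝓕 p x (asympDelta 𝓕 p x) := by
  refine hasLowerEstimate_of_forall_isAdmissible h𝓕 fun k a ha => ?_
  have hS : 0 ≤ ∑ i, p (blockVec x (a i)) := Finset.sum_nonneg fun _ _ => apply_nonneg _ _
  rcases hS.eq_or_lt with h | h
  · rw [← h, mul_zero]
    exact apply_nonneg _ _
  · rw [← le_div_iff₀ h]
    refine Real.sSup_le (fun ε hε => ?_) (by positivity)
    rw [le_div_iff₀ h]
    exact hε.2 k a ha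

/-- The blocks are summed over each piece: the `𝓖` estimate applies within the pieces and the `𝓕`
estimate to the resulting sums. -/
theorem HasLowerEstimate.famComp {ε : ℝ} (hδ : 0 ≤ δ) (h₁ : HasLowerEstimate 𝓕 p x δ)
    (h₂ : HasLowerEstimate 𝓖 p x ε) : HasLowerEstimate (famComp 𝓕 𝓖) p x (δ * ε) := by
  classical
  intro s hs b hb
  obtain ⟨φ, a1, a2, a3, a4, a5, a6⟩ := exists_label_of_mem_famComp hs
  have hfam : IsBlockFamily (s.image φ) fun c => ∑ m ∈ s.filter (φ · = c), b m := by
    intro c hc k hkc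
    obtain ⟨m, hmc, hk⟩ := Finset.mem_biUnion.1 (Finsupp.support_finsetSum hkc)
    obtain ⟨hm, rfl⟩ := Finset.mem_filter.1 hmc
    refine ⟨(a2 m hm).trans (hb m hm k hk).1, fun c' hc' hlt => ?_⟩
    obtain ⟨m', hm', rfl⟩ := Finset.mem_image.1 hc'
    refine (hb m hm k hk).2 _ (a1 m' hm') ?_
    by_contra hcon
    have := a4 (a1 m' hm') hm (not_lt.1 hcon)
    rw [a3 m' hm'] at this
    omega
  have h3 := h₁ _ a5 _ hfam
  have hmap : ∀ c, blockVec x (∑ m ∈ s.filter (φ · = c), b m) =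
      ∑ m ∈ s.filter (φ · = c), blockVec x (b m) := fun c => map_sum _ _ _
  simp only [hmap] at h3
  have hmaps : ∀ m ∈ s, φ m ∈ s.image φ := fun m hm => Finset.mem_image_of_mem φ hm
  rw [← Finset.sum_fiberwise_of_maps_to hmaps fun m => p (blockVec x (b m)),
    ← Finset.sum_fiberwise_of_maps_to hmaps fun m => blockVec x (b m), mul_assoc, Finset.mul_sum]
  refine (mul_le_mul_of_nonneg_left (Finset.sum_le_sum fun c hc => ?_) hδ).trans h3
  refine h₂ _ (a6 c hc) b fun m hm k hk => ?_
  have hm' := (Finset.mem_filter.1 hm).1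
  exact ⟨(hb m hm' k hk).1, fun l hl => (hb m hm' k hk).2 l (Finset.mem_filter.1 hl).1⟩

theorem HasLowerEstimate.of_blocks (h : HasLowerEstimate 𝓖 p x δ) {a : ℕ → (ℕ →₀ ℝ)}
    {μ : ℕ → ℕ} (hμ : StrictMono μ) (ha : ∀ i, ∀ k ∈ (a i).support, μ i ≤ k ∧ k < μ (i + 1))
    (h𝓕 : ∀ F ∈ 𝓕, F.image μ ∈ 𝓖) :
    HasLowerEstimate 𝓕 p (fun i => blockVec x (a i)) δ := by
  intro s hs b hb
  let b' : ℕ → (ℕ →₀ ℝ) := Function.extend μ (fun m => Finsupp.linearCombination ℝ a (b m)) 0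
  have hb' : ∀ m, b' (μ m) = Finsupp.linearCombination ℝ a (b m) := fun m =>
    hμ.injective.extend_apply _ _ _
  have := h _ (h𝓕 s hs) b' ?_
  · rw [Finset.sum_image hμ.injective.injOn, Finset.sum_image hμ.injective.injOn] at this
    simpa only [hb', blockVec_linearCombination] using this
  · intro c hc k hk
    obtain ⟨m, hm, rfl⟩ := Finset.mem_image.1 hc
    rw [hb'] at hk
    obtain ⟨i, hi, hk⟩ := exists_mem_support_of_mem_support_linearCombination hk
    refine ⟨(hμ.monotone (hb m hm i hi).1).trans (ha i k hk).1, fun c' hc' hlt => ?_⟩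
    obtain ⟨m', hm', rfl⟩ := Finset.mem_image.1 hc'
    exact (ha i k hk).2.trans_le
      (hμ.monotone ((hb m hm i hi).2 m' hm' (hμ.lt_iff_lt.1 hlt)))

theorem HasLowerEstimate.of_isBlockBasis (h : HasLowerEstimate 𝓕 p x δ)
    (h𝓕 : IsRegularFamily 𝓕) {z : ℕ → X} (hz : IsBlockBasis z x) : HasLowerEstimate 𝓕 p z δ := by
  obtain ⟨a, ha, hz⟩ := hz
  obtain ⟨μ, hμ, -, hle⟩ := ha.exists_strictMono
  rw [funext hz]
  exact h.of_blocks hμ hle fun F hF =>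
    h𝓕.spreading F hF μ (hμ.strictMonoOn _) fun _ _ => hμ.le_apply

theorem HasLowerEstimate.comp (h : HasLowerEstimate 𝓖 p x δ) {f : ℕ → ℕ} (hf : StrictMono f)
    (h𝓕 : ∀ F ∈ 𝓕, F.image f ∈ 𝓖) : HasLowerEstimate 𝓕 p (fun i => x (f i)) δ := by
  have := h.of_blocks (a := fun i => Finsupp.single (f i) 1) hf (fun i k hk => ?_) h𝓕
  · simpa using this
  · rw [Finsupp.support_single _ one_ne_zero, Finset.mem_singleton] at hk
    subst hk
    exact ⟨le_rfl, hf (Nat.lt_succ_self i)⟩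

end

theorem blockVec_zero {X : Type*} [AddCommGroup X] [Module ℝ X] (x : ℕ → X) :
    blockVec x 0 = 0 :=
  map_zero _

theorem blockVec_add {X : Type*} [AddCommGroup X] [Module ℝ X] (x : ℕ → X) (c d : ℕ →₀ ℝ) :
    blockVec x (c + d) = blockVec x c + blockVec x d :=
  map_add _ _ _

/-! ### Basis projections -/

/-- The operators `Q k`, bounded by `K`, act as the initial projections of the sequence `x` of
nonzero vectors. -/
structure IsBasisProjection {E : Type*} [NormedAddCommGroup E] [NormedSpace ℝ E]
    (x : ℕ → E) (Q : ℕ → E →L[ℝ] E) (K : ℝ) : Prop where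
  ne_zero : ∀ i, x i ≠ 0
  norm_le : ∀ k v, ‖Q k v‖ ≤ K * ‖v‖
  apply_eq : ∀ k i, Q k (x i) = if i < k then x i else 0

theorem SchauderBasis.exists_isBasisProjection {X : Type*} [NormedAddCommGroup X]
    [NormedSpace ℝ X] [CompleteSpace X] (e : SchauderBasis ℝ X) :
    ∃ K, IsBasisProjection (e : ℕ → X) (SchauderBasis.proj e) K := by
  obtain ⟨K, hK⟩ := SchauderBasis.exists_norm_proj_le e
  exact ⟨K, e.linearIndependent.ne_zero, fun k v => (SchauderBasis.proj e k).le_of_opNorm_le (hK k) v,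
    fun k i => SchauderBasis.proj_apply_basis_mem e k i⟩

namespace IsBasisProjection

variable {E : Type*} [NormedAddCommGroup E] [NormedSpace ℝ E] {x : ℕ → E} {Q : ℕ → E →L[ℝ] E}
  {K : ℝ}

theorem one_le (h : IsBasisProjection x Q K) : 1 ≤ K := by
  have h1 := h.norm_le 1 (x 0)
  rw [h.apply_eq, if_pos Nat.zero_lt_one] at h1
  have h2 := norm_pos_iff.2 (h.ne_zero 0)
  by_contra hcon
  nlinarith

theorem apply_blockVec (h : IsBasisProjection x Q K) (k : ℕ) (c : ℕ →₀ ℝ) :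
    Q k (blockVec x c) = blockVec x (c.filter (· < k)) := by
  induction c using Finsupp.induction_linear with
  | zero => rw [Finsupp.filter_zero, blockVec_zero, map_zero]
  | add f g hf hg => rw [blockVec_add, map_add, hf, hg, Finsupp.filter_add, blockVec_add]
  | single i r =>
    by_cases hi : i < k
    · simp [h.apply_eq, hi]
    · simp [h.apply_eq, hi]

theorem sub_apply_blockVec (h : IsBasisProjection x Q K) (k : ℕ) (c : ℕ →₀ ℝ) :
    Q (k + 1) (blockVec x c) - Q k (blockVec x c) = c k • x k := by
  induction c using Finsupp.induction_linear with
  | zero => simp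
  | add f g hf hg =>
    simp only [map_add, Finsupp.add_apply, add_smul, ← hf, ← hg]
    abel
  | single i r =>
    simp only [blockVec, Finsupp.linearCombination_single, map_smul, h.apply_eq]
    rcases lt_trichotomy i k with hi | rfl | hi
    · simp [hi, hi.trans (Nat.lt_succ_self k), hi.ne]
    · simp
    · simp [hi.not_gt, hi.ne', show ¬ i < k + 1 by omega]

theorem norm_coeff_le (h : IsBasisProjection x Q K) (k : ℕ) (c : ℕ →₀ ℝ) :
    |c k| * ‖x k‖ ≤ 2 * K * ‖blockVec x c‖ := by
  rw [← Real.norm_eq_abs, ← norm_smul, ← h.sub_apply_blockVec]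
  refine (norm_sub_le _ _).trans ?_
  linarith [h.norm_le (k + 1) (blockVec x c), h.norm_le k (blockVec x c)]

theorem blockVec_ne_zero (h : IsBasisProjection x Q K) {c : ℕ →₀ ℝ} (hc : c ≠ 0) :
    blockVec x c ≠ 0 := by
  intro h0
  refine hc (Finsupp.ext fun k => ?_)
  have := h.norm_coeff_le k c
  rw [h0, norm_zero, mul_zero] at this
  have h1 := norm_pos_iff.2 (h.ne_zero k)
  have h2 : |c k| ≤ 0 := by
    by_contra hcon
    have := mul_pos (not_le.1 hcon) h1
    linarith
  simpa using h2

/-- Cutting before the first support point of the `k`-th block keeps the earlier blocks and kills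
the later ones, with the same bound `K`. -/
theorem exists_of_isBlockBasis (h : IsBasisProjection x Q K) {z : ℕ → E}
    (hz : IsBlockBasis z x) : ∃ Q', IsBasisProjection z Q' K := by
  obtain ⟨a, ha, hz⟩ := hz
  obtain ⟨μ, hμ, -, hle⟩ := ha.exists_strictMono
  refine ⟨fun k => Q (μ k), fun i => ?_, fun k => h.norm_le _, fun k i => ?_⟩
  · rw [hz]
    exact h.blockVec_ne_zero (ha.1 i)
  · rw [hz, h.apply_blockVec]
    split_ifs with hik
    · rw [Finsupp.filter_eq_self_iff _ _ |>.2]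
      intro l hl
      exact (hle i l (Finsupp.mem_support_iff.2 hl)).2.trans_le (hμ.monotone hik)
    · rw [Finsupp.filter_eq_zero_iff _ _ |>.2, blockVec_zero]
      intro l hl
      by_contra hcon
      have h1 := (hle i l (Finsupp.mem_support_iff.2 hcon)).1
      have h2 := hμ.monotone (not_lt.1 hik)
      omega

theorem linearIndependent (h : IsBasisProjection x Q K) : LinearIndependent ℝ x := by
  rw [linearIndependent_iff]
  intro c hc
  by_contra hcon
  exact h.blockVec_ne_zero hcon hc

theorem not_finiteDimensional_topologicalClosure (h : IsBasisProjection x Q K) :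
    ¬ FiniteDimensional ℝ (Submodule.span ℝ (Set.range x)).topologicalClosure := by
  intro hfin
  have : LinearIndependent ℝ fun i => (⟨x i, Submodule.le_topologicalClosure _
      (Submodule.subset_span (Set.mem_range_self i))⟩ :
      (Submodule.span ℝ (Set.range x)).topologicalClosure) :=
    LinearIndependent.of_comp (Submodule.subtype _) h.linearIndependent
  exact not_finite_iff_infinite.2 (inferInstance : Infinite ℕ) this.finite

theorem exists_inClosedSpan (h : IsBasisProjection x Q K) :
    ∃ Q', IsBasisProjection (inClosedSpan x) Q' K := by
  have hmem : ∀ k, ∀ v ∈ closedSpan x, Q k v ∈ closedSpan x := by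
    intro k
    change closedSpan x ≤ (closedSpan x).comap (Q k : E →ₗ[ℝ] E)
    refine Submodule.topologicalClosure_minimal _ ?_ ?_
    · rw [Submodule.span_le]
      rintro _ ⟨i, rfl⟩
      change Q k (x i) ∈ closedSpan x
      rw [h.apply_eq]
      split_ifs
      · exact (inClosedSpan x i).2
      · exact Submodule.zero_mem _
    · exact (Submodule.isClosed_topologicalClosure _).preimage (Q k).continuous
  refine ⟨fun k => ((Q k).comp (closedSpan x).subtypeL).codRestrict (closedSpan x)
    fun v => hmem k v v.2, fun i h0 => h.ne_zero i ?_, fun k v => h.norm_le k v, fun k i => ?_⟩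
  · exact congrArg Subtype.val h0
  · refine Subtype.ext ?_
    refine (h.apply_eq k i).trans ?_
    split_ifs <;> rfl

/-! ### Block sequences near an infinite-dimensional subspace -/

theorem exists_blockVec_near (h : IsBasisProjection x Q K) {W : Submodule ℝ E}
    (hW : W ≤ (Submodule.span ℝ (Set.range x)).topologicalClosure)
    (hinf : ¬ FiniteDimensional ℝ W) (N : ℕ) {η : ℝ} (hη : 0 < η) :
    ∃ w ∈ W, ‖w‖ = 1 ∧ ∃ c : ℕ →₀ ℝ, (∀ k ∈ c.support, N ≤ k) ∧ ‖w - blockVec x c‖ < η := by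
  -- `Q N` maps the closed span into a space of finite dimension, so it is not injective on `W`.
  obtain ⟨w, hwW, hw0, hQw⟩ : ∃ w ∈ W, w ≠ 0 ∧ Q N w = 0 := by
    by_contra! hcon
    let V := Submodule.span ℝ (Set.range fun i : Fin N => x i)
    have hV : FiniteDimensional ℝ V := FiniteDimensional.span_of_finite ℝ (Set.finite_range _)
    have hmem : ∀ v ∈ (Submodule.span ℝ (Set.range x)).topologicalClosure, Q N v ∈ V := by
      change _ ≤ V.comap (Q N : E →ₗ[ℝ] E)
      refine Submodule.topologicalClosure_minimal _ ?_ ?_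
      · rw [Submodule.span_le]
        rintro _ ⟨i, rfl⟩
        change Q N (x i) ∈ V
        rw [h.apply_eq]
        split_ifs with hi
        · exact Submodule.subset_span ⟨⟨i, hi⟩, rfl⟩
        · exact Submodule.zero_mem _
      · exact V.closed_of_finiteDimensional.preimage (Q N).continuous
    let T : W →ₗ[ℝ] V := ((Q N : E →ₗ[ℝ] E).comp W.subtype).codRestrict V
      fun v => hmem v (hW v.2)
    refine hinf (FiniteDimensional.of_injective T ?_)
    rw [injective_iff_map_eq_zero]
    intro v hv
    by_contra hne
    exact hcon v v.2 (fun h0 => hne (Subtype.ext h0)) (congrArg Subtype.val hv)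
  have hK := h.one_le
  have hnorm := norm_pos_iff.2 hw0
  have hmem : ‖w‖⁻¹ • w ∈ W := W.smul_mem _ hwW
  refine ⟨‖w‖⁻¹ • w, hmem, by rw [norm_smul, norm_inv, norm_norm, inv_mul_cancel₀ hnorm.ne'], ?_⟩
  have hQw' : Q N (‖w‖⁻¹ • w) = 0 := by rw [map_smul, hQw, smul_zero]
  set v := ‖w‖⁻¹ • w
  -- The first `N` coordinates of the approximant are removed by `1 - Q N`, which fixes `v` and has
  -- norm at most `1 + K`.
  obtain ⟨u, hu, hvu⟩ := Metric.mem_closure_iff.1 (hW hmem) (η / (1 + K)) (by positivity)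
  obtain ⟨c, rfl⟩ := (Finsupp.mem_span_range_iff_exists_finsupp).1 hu
  change dist v (blockVec x c) < _ at hvu
  refine ⟨c.filter (fun k => ¬ k < N), fun k hk => ?_, ?_⟩
  · rw [Finsupp.support_filter, Finset.mem_filter] at hk
    exact not_lt.1 hk.2
  · have h1 : blockVec x (c.filter (fun k => ¬ k < N)) = blockVec x c - Q N (blockVec x c) := by
      rw [h.apply_blockVec, eq_sub_iff_add_eq, ← map_add, add_comm,
        Finsupp.filter_add_filter_not]
    have h2 : v - blockVec x (c.filter (fun k => ¬ k < N)) =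
        (v - blockVec x c) - Q N (v - blockVec x c) := by
      rw [h1, map_sub, hQw']
      abel
    rw [dist_eq_norm, lt_div_iff₀ (by positivity)] at hvu
    rw [h2]
    refine (norm_sub_le _ _).trans_lt ?_
    linarith [h.norm_le N (v - blockVec x c)]

theorem exists_isSuccessive_near (h : IsBasisProjection x Q K) {W : Submodule ℝ E}
    (hW : W ≤ (Submodule.span ℝ (Set.range x)).topologicalClosure)
    (hinf : ¬ FiniteDimensional ℝ W) {η : ℕ → ℝ} (hη : ∀ i, 0 < η i) (hη' : ∀ i, η i ≤ 1) :
    ∃ a : ℕ → (ℕ →₀ ℝ), IsSuccessive a ∧ ∃ w : ℕ → E, ∀ i, w i ∈ W ∧ ‖w i‖ = 1 ∧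
      ‖w i - blockVec x (a i)‖ < η i := by
  choose w hwW hw1 c hc hwc using fun N i => h.exists_blockVec_near hW hinf N (hη i)
  -- Gliding hump: `n (i + 1)` is the first position after the support of the `i`-th block.
  let n : ℕ → ℕ := fun i => Nat.rec 0 (fun i N => (c N i).support.sup id + 1) i
  have hn : ∀ i, n (i + 1) = (c (n i) i).support.sup id + 1 := fun i => rfl
  have hlt : ∀ i, ∀ k ∈ (c (n i) i).support, k < n (i + 1) := fun i k hk => by
    rw [hn]
    exact Nat.lt_succ_of_le (Finset.le_sup (f := id) hk)
  have hne : ∀ i, c (n i) i ≠ 0 := by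
    intro i h0
    have := hwc (n i) i
    rw [h0, blockVec_zero, sub_zero, hw1] at this
    linarith [hη' i]
  have hmono : Monotone n := monotone_nat_of_le_succ fun i => by
    obtain ⟨k, hk⟩ := Finsupp.support_nonempty_iff.2 (hne i)
    exact (hc _ i k hk).trans (hlt i k hk).le
  refine ⟨fun i => c (n i) i, ⟨hne, fun i j hij k hk l hl => ?_⟩, fun i => w (n i) i,
    fun i => ⟨hwW _ i, hw1 _ i, hwc _ i⟩⟩
  exact (hlt i k hk).trans_le ((hmono hij).trans (hc _ j l hl))

theorem exists_isBlockBasis_near (h : IsBasisProjection x Q K) {W : Submodule ℝ E}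
    (hW : W ≤ (Submodule.span ℝ (Set.range x)).topologicalClosure)
    (hinf : ¬ FiniteDimensional ℝ W) {ε : ℝ} (hε : 0 < ε) (hε' : ε ≤ 1) :
    ∃ z : ℕ → E, IsBlockBasis z x ∧
      ∀ c : ℕ →₀ ℝ, ∃ w ∈ W, ‖blockVec z c - w‖ ≤ ε * ‖blockVec z c‖ := by
  have hK := h.one_le
  have hτ : 0 < ε / (4 * K) := by positivity
  have hτ' : ε / (4 * K) ≤ 1 := by
    rw [div_le_one (by positivity)]
    linarith
  have hη : ∀ i : ℕ, ε / (4 * K) / 2 / 2 ^ i ≤ 1 / 2 := by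
    intro i
    refine (div_le_self (by positivity) (one_le_pow₀ one_le_two)).trans ?_
    linarith
  obtain ⟨a, ha, w, hw⟩ := h.exists_isSuccessive_near hW hinf
    (η := fun i => ε / (4 * K) / 2 / 2 ^ i) (fun i => by positivity)
    (fun i => (hη i).trans (by norm_num))
  have hz : IsBlockBasis (fun i => blockVec x (a i)) x := ⟨a, ha, fun _ => rfl⟩
  obtain ⟨Q', hQ'⟩ := h.exists_of_isBlockBasis hz
  refine ⟨_, hz, fun c => ⟨blockVec w c, ?_, ?_⟩⟩
  · refine Submodule.sum_mem _ fun i _ => W.smul_mem _ (hw i).1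
  · set z := fun i => blockVec x (a i) with hzdef
    -- The coordinate bound `2 * K` is doubled because `‖z i‖ ≥ 1 / 2`; the perturbations were
    -- chosen to sum to at most `ε / (4 * K)` for this reason.
    have hcoef : ∀ i, |c i| ≤ 4 * K * ‖blockVec z c‖ := by
      intro i
      have h1 := hQ'.norm_coeff_le i c
      have h2 : 1 / 2 ≤ ‖z i‖ := by
        have h3 := norm_sub_norm_le (w i) (z i)
        have h4 := (hw i).2.2
        have h5 := hη i
        rw [(hw i).2.1] at h3
        simp only [hzdef] at h3 ⊢
        linarith
      nlinarith [abs_nonneg (c i)]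
    have hsub : blockVec z c - blockVec w c = ∑ i ∈ c.support, c i • (z i - w i) := by
      simp [blockVec, Finsupp.linearCombination_apply, Finsupp.sum, smul_sub]
    have hsum : ∑ i ∈ c.support, ε / (4 * K) / 2 / 2 ^ i ≤ ε / (4 * K) :=
      sum_le_hasSum _ (fun i _ => by positivity) (hasSum_geometric_two' (ε / (4 * K)))
    rw [hsub]
    calc ‖∑ i ∈ c.support, c i • (z i - w i)‖
        ≤ ∑ i ∈ c.support, ‖c i • (z i - w i)‖ := norm_sum_le _ _
      _ ≤ ∑ i ∈ c.support, 4 * K * ‖blockVec z c‖ * (ε / (4 * K) / 2 / 2 ^ i) := by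
          refine Finset.sum_le_sum fun i _ => ?_
          rw [norm_smul, Real.norm_eq_abs, norm_sub_rev]
          exact mul_le_mul (hcoef i) (hw i).2.2.le (norm_nonneg _) (by positivity)
      _ = 4 * K * ‖blockVec z c‖ * ∑ i ∈ c.support, ε / (4 * K) / 2 / 2 ^ i := by
          rw [Finset.mul_sum]
      _ ≤ 4 * K * ‖blockVec z c‖ * (ε / (4 * K)) :=
          mul_le_mul_of_nonneg_left hsum (by positivity)
      _ = ε * ‖blockVec z c‖ := by
          field_simp

end IsBasisProjection

/-! ### Bounded distortion -/

section

variable {E : Type*} [NormedAddCommGroup E] [NormedSpace ℝ E]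

theorem exists_ne_zero_of_not_finiteDimensional {W : Submodule ℝ E}
    (hW : ¬ FiniteDimensional ℝ W) : ∃ w ∈ W, w ≠ 0 := by
  by_contra! hcon
  exact hW ((Submodule.eq_bot_iff W).2 hcon ▸ inferInstance)

theorem IsOfBoundedDistortion.exists_submodule {D D' : ℝ} (hD : IsOfBoundedDistortion D E)
    (hDD' : D < D') {p : Seminorm ℝ E} (hp : IsEquivNorm p) {Z : Submodule ℝ E}
    (hZ : IsClosed (Z : Set E)) (hinf : ¬ FiniteDimensional ℝ Z) :
    ∃ W ≤ Z, ¬ FiniteDimensional ℝ W ∧ 1 < D' ∧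
      ∀ u ∈ W, ∀ v ∈ W, p u * ‖v‖ ≤ D' * (p v * ‖u‖) := by
  have hd := (hD p hp Z hZ hinf).trans_lt hDD'
  unfold distortion at hd
  obtain ⟨r, ⟨W, hWZ, -, hW, rfl⟩, hr⟩ := exists_lt_of_csInf_lt (by exact ⟨_, Z, le_rfl, hZ, hinf, rfl⟩) hd
  obtain ⟨c, C, hc, hC, hcC⟩ := hp
  have hpos : ∀ v : E, v ≠ 0 → 0 < p v := fun v hv =>
    (mul_pos hc (norm_pos_iff.2 hv)).trans_le (hcC v).1
  -- Equivalence of the norms makes the real supremum genuine rather than the default 0.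
  have hbdd : BddAbove {t : ℝ | ∃ x ∈ W, ∃ y ∈ W, ‖x‖ = 1 ∧ ‖y‖ = 1 ∧ t = p x / p y} := by
    refine ⟨C / c, ?_⟩
    rintro _ ⟨x, -, y, -, hx, hy, rfl⟩
    have h1 := (hcC x).2
    have h2 := (hcC y).1
    rw [hx, mul_one] at h1
    rw [hy, mul_one] at h2
    exact div_le_div₀ hC.le h1 hc h2
  have hunit : ∀ v : E, v ≠ 0 → ‖‖v‖⁻¹ • v‖ = 1 := fun v hv => by
    rw [norm_smul, norm_inv, norm_norm, inv_mul_cancel₀ (norm_ne_zero_iff.2 hv)]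
  have hpunit : ∀ v : E, p (‖v‖⁻¹ • v) = ‖v‖⁻¹ * p v := fun v => by
    rw [map_smul_eq_mul, norm_inv, norm_norm]
  have hle : ∀ u ∈ W, ∀ v ∈ W, u ≠ 0 → v ≠ 0 →
      (‖u‖⁻¹ * p u) / (‖v‖⁻¹ * p v) < D' := by
    intro u hu v hv hu0 hv0
    refine (le_csSup hbdd ⟨‖u‖⁻¹ • u, W.smul_mem _ hu, ‖v‖⁻¹ • v, W.smul_mem _ hv,
      hunit u hu0, hunit v hv0, ?_⟩).trans_lt hr
    rw [hpunit, hpunit]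
  refine ⟨W, hWZ, hW, ?_, fun u hu v hv => ?_⟩
  · obtain ⟨w, hw, hw0⟩ := exists_ne_zero_of_not_finiteDimensional hW
    have := hle w hw w hw hw0 hw0
    rwa [div_self (mul_pos (inv_pos.2 (norm_pos_iff.2 hw0)) (hpos w hw0)).ne'] at this
  · rcases eq_or_ne u 0 with rfl | hu0
    · simp
    rcases eq_or_ne v 0 with rfl | hv0
    · simp
    have h1 := hle u hu v hv hu0 hv0
    have hu' := norm_pos_iff.2 hu0
    have hv' := norm_pos_iff.2 hv0
    have hpv := hpos v hv0
    rw [div_lt_iff₀ (by positivity)] at h1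
    have h2 := mul_lt_mul_of_pos_right h1 (mul_pos hu' hv')
    field_simp at h2
    linarith

theorem IsOfBoundedDistortion.one_le {D : ℝ} (hD : IsOfBoundedDistortion D E)
    (hinf : ∃ Z : Submodule ℝ E, IsClosed (Z : Set E) ∧ ¬ FiniteDimensional ℝ Z) : 1 ≤ D := by
  obtain ⟨Z, hZ, hinf⟩ := hinf
  refine le_of_forall_gt_imp_ge_of_dense fun D' hD' => ?_
  have hp : IsEquivNorm (normSeminorm ℝ E) := ⟨1, 1, one_pos, one_pos, fun x => by simp⟩
  obtain ⟨-, -, -, h, -⟩ := hD.exists_submodule hD' hp hZ hinf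
  exact h.le

theorem exists_pos_lt_one_mul_le {D' D'' : ℝ} (h : D' < D'') :
    ∃ t : ℝ, 0 < t ∧ t < 1 ∧ D' * (1 + t) ^ 2 ≤ D'' * (1 - t) ^ 2 := by
  have hcont : ContinuousAt (fun t : ℝ => D'' * (1 - t) ^ 2 - D' * (1 + t) ^ 2) 0 := by
    fun_prop
  have h1 := hcont.eventually (lt_mem_nhds (a := 0) (by simpa using h))
  have h2 : ∀ᶠ t : ℝ in 𝓝[>] 0, 0 < t ∧ t < 1 := Ioo_mem_nhdsGT one_pos
  obtain ⟨t, ht, ht'⟩ := (h2.and (h1.filter_mono nhdsWithin_le_nhds)).exists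
  exact ⟨t, ht.1, ht.2, by linarith⟩

/-- Distortion gives a subspace, but the constants concern block bases. A block basis close to the
subspace inherits the bound, with the gap between `D` and `D''` absorbing the perturbation. -/
theorem IsOfBoundedDistortion.exists_isBlockBasis {D D'' : ℝ} (hD : IsOfBoundedDistortion D E)
    (hDD : D < D'') {p : Seminorm ℝ E} (hp : IsEquivNorm p) {x : ℕ → E} {Q : ℕ → E →L[ℝ] E}
    {K : ℝ} (h : IsBasisProjection x Q K) :
    ∃ z : ℕ → E, IsBlockBasis z x ∧ ∀ c d : ℕ →₀ ℝ,
      p (blockVec z c) * ‖blockVec z d‖ ≤ D'' * (p (blockVec z d) * ‖blockVec z c‖) := by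
  obtain ⟨D', hDD', hD'⟩ := exists_between hDD
  obtain ⟨W, hWZ, hW, hD'1, hWp⟩ := hD.exists_submodule hDD' hp
    (Submodule.isClosed_topologicalClosure _) h.not_finiteDimensional_topologicalClosure
  obtain ⟨t, ht0, ht1, ht⟩ := exists_pos_lt_one_mul_le hD'
  obtain ⟨c₀, C, hc₀, hC, hcC⟩ := hp
  have hcC' : c₀ ≤ C := by
    have h1 := norm_pos_iff.2 (h.ne_zero 0)
    exact le_of_mul_le_mul_right ((hcC (x 0)).1.trans (hcC (x 0)).2) h1
  -- With relative error `t * c₀ / C` in norm, the relative error is at most `t` both for the norm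
  -- and, after the loss `C / c₀`, for `p`.
  have hε1 : t * c₀ / C ≤ t := by
    rw [div_le_iff₀ hC]
    exact mul_le_mul_of_nonneg_left hcC' ht0.le
  obtain ⟨z, hz, hzW⟩ := h.exists_isBlockBasis_near hWZ hW (ε := t * c₀ / C) (by positivity)
    (hε1.trans ht1.le)
  refine ⟨z, hz, fun c d => ?_⟩
  have hclose : ∀ c : ℕ →₀ ℝ, ∃ w ∈ W, ‖blockVec z c - w‖ ≤ t * ‖blockVec z c‖ ∧
      p (blockVec z c - w) ≤ t * p (blockVec z c) := by
    intro c
    obtain ⟨w, hw, hle⟩ := hzW c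
    refine ⟨w, hw, hle.trans (mul_le_mul_of_nonneg_right hε1 (norm_nonneg _)), ?_⟩
    calc p (blockVec z c - w) ≤ C * ‖blockVec z c - w‖ := (hcC _).2
      _ ≤ C * (t * c₀ / C * ‖blockVec z c‖) := mul_le_mul_of_nonneg_left hle hC.le
      _ = t * (c₀ * ‖blockVec z c‖) := by field_simp
      _ ≤ t * p (blockVec z c) := mul_le_mul_of_nonneg_left (hcC _).1 ht0.le
  obtain ⟨wc, hwc, hc1, hc2⟩ := hclose c
  obtain ⟨wd, hwd, hd1, hd2⟩ := hclose d
  set u := blockVec z c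
  set v := blockVec z d
  have e1 : (1 - t) * p u ≤ p wc := by
    have := map_add_le_add p (u - wc) wc
    rw [sub_add_cancel] at this
    linarith
  have e2 : (1 - t) * ‖v‖ ≤ ‖wd‖ := by
    have := norm_add_le (v - wd) wd
    rw [sub_add_cancel] at this
    linarith
  have e3 : p wd ≤ (1 + t) * p v := by
    have := map_sub_le_add p v (v - wd)
    rw [sub_sub_cancel] at this
    linarith
  have e4 : ‖wc‖ ≤ (1 + t) * ‖u‖ := by
    have := norm_sub_le u (u - wc)
    rw [sub_sub_cancel] at this
    linarith
  have e5 := hWp wc hwc wd hwd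
  have hpu := apply_nonneg p u
  have hpv := apply_nonneg p v
  have ht1' : 0 < 1 - t := by linarith
  have e6 : (1 - t) * p u * ((1 - t) * ‖v‖) ≤ p wc * ‖wd‖ :=
    mul_le_mul e1 e2 (by positivity) (apply_nonneg p wc)
  have e7 : p wd * ‖wc‖ ≤ (1 + t) * p v * ((1 + t) * ‖u‖) :=
    mul_le_mul e3 e4 (norm_nonneg _) (by positivity)
  have e8 : D' * (p wd * ‖wc‖) ≤ D' * ((1 + t) * p v * ((1 + t) * ‖u‖)) :=
    mul_le_mul_of_nonneg_left e7 (by linarith)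
  have e9 := mul_le_mul_of_nonneg_right ht (mul_nonneg hpv (norm_nonneg u))
  refine le_of_mul_le_mul_left ?_ (pow_pos ht1' 2)
  calc (1 - t) ^ 2 * (p u * ‖v‖) = (1 - t) * p u * ((1 - t) * ‖v‖) := by ring
    _ ≤ D' * ((1 + t) * p v * ((1 + t) * ‖u‖)) := e6.trans (e5.trans e8)
    _ = D' * (1 + t) ^ 2 * (p v * ‖u‖) := by ring
    _ ≤ D'' * (1 - t) ^ 2 * (p v * ‖u‖) := e9
    _ = (1 - t) ^ 2 * (D'' * (p v * ‖u‖)) := by ring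

theorem HasLowerEstimate.norm_of_distortion {𝓕 : Set (Finset ℕ)} {p : Seminorm ℝ E}
    (hp : IsEquivNorm p) {z : ℕ → E} {δ D : ℝ} (hδ : 0 ≤ δ) (hD : 0 < D)
    (h : HasLowerEstimate 𝓕 p z δ) (hz : ∀ c d : ℕ →₀ ℝ,
      p (blockVec z c) * ‖blockVec z d‖ ≤ D * (p (blockVec z d) * ‖blockVec z c‖)) :
    HasLowerEstimate 𝓕 (normSeminorm ℝ E) z (D⁻¹ * δ) := by
  intro s hs b hb
  simp only [coe_normSeminorm]
  have h1 := h s hs b hb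
  have hsum : ∑ m ∈ s, blockVec z (b m) = blockVec z (∑ m ∈ s, b m) := (map_sum _ _ _).symm
  rw [hsum] at h1 ⊢
  have h2 : p (blockVec z (∑ m ∈ s, b m)) * ∑ m ∈ s, ‖blockVec z (b m)‖ ≤
      D * ((∑ m ∈ s, p (blockVec z (b m))) * ‖blockVec z (∑ m ∈ s, b m)‖) := by
    rw [Finset.mul_sum, Finset.sum_mul, Finset.mul_sum]
    exact Finset.sum_le_sum fun m _ => hz _ _
  set u := blockVec z (∑ m ∈ s, b m)
  set S := ∑ m ∈ s, ‖blockVec z (b m)‖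
  set P := ∑ m ∈ s, p (blockVec z (b m))
  obtain ⟨c₀, C, hc₀, hC, hcC⟩ := hp
  rw [inv_mul_eq_div, div_mul_eq_mul_div, div_le_iff₀ hD]
  -- If the sum vanishes, one cannot cancel `p u`; the estimate for `p` then forces `δ * S ≤ 0`
  -- directly.
  rcases eq_or_ne u 0 with h0 | h0
  · rw [h0, map_zero] at h1
    have h3 : c₀ * S ≤ P := by
      rw [Finset.mul_sum]
      exact Finset.sum_le_sum fun m _ => (hcC _).1
    have h4 : c₀ * (δ * S) ≤ 0 := by
      calc c₀ * (δ * S) = δ * (c₀ * S) := by ring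
        _ ≤ δ * P := mul_le_mul_of_nonneg_left h3 hδ
        _ ≤ 0 := h1
    rw [h0, norm_zero, zero_mul]
    by_contra hcon
    have := mul_pos hc₀ (not_le.1 hcon)
    linarith
  · have hpu : 0 < p u := (mul_pos hc₀ (norm_pos_iff.2 h0)).trans_le (hcC u).1
    refine le_of_mul_le_mul_left ?_ hpu
    calc p u * (δ * S) = δ * (p u * S) := by ring
      _ ≤ δ * (D * (P * ‖u‖)) := mul_le_mul_of_nonneg_left h2 hδ
      _ = δ * P * (D * ‖u‖) := by ring
      _ ≤ p u * (D * ‖u‖) := mul_le_mul_of_nonneg_right h1 (by positivity)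
      _ = p u * (‖u‖ * D) := by ring

end

/-! ### Interval systems -/

/-- The intervals `[l, r l)`, `l ∈ s`, are nonempty and pairwise disjoint. -/
def IsIntervalSystem (s : Finset ℕ) (r : ℕ → ℕ) : Prop :=
  ∀ l ∈ s, l < r l ∧ ∀ l' ∈ s, l < l' → r l ≤ l'

section

variable {E : Type*} [NormedAddCommGroup E] [NormedSpace ℝ E]

/-- `∑ ‖(Q (r l) - Q l) v‖`, summed over `l ∈ s`. -/
def intervalSum (Q : ℕ → E →L[ℝ] E) (s : Finset ℕ) (r : ℕ → ℕ) (v : E) : ℝ :=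
  ∑ l ∈ s, ‖Q (r l) v - Q l v‖

/-- The supremum of the sums `∑ ‖(Q (r l) - Q l) v‖` over all interval systems with
left end points forming a member of `𝓕`. -/
noncomputable def variation (Q : ℕ → E →L[ℝ] E) (𝓕 : Set (Finset ℕ)) (v : E) : ℝ :=
  sSup {t | ∃ s ∈ 𝓕, ∃ r, IsIntervalSystem s r ∧ t = intervalSum Q s r v}

/-- The sums over interval systems with left end points in `𝓕` are bounded by `B ‖v‖`. -/
def HasBoundedVariation (Q : ℕ → E →L[ℝ] E) (𝓕 : Set (Finset ℕ)) (B : ℝ) : Prop :=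
  ∀ s ∈ 𝓕, ∀ r, IsIntervalSystem s r → ∀ v, intervalSum Q s r v ≤ B * ‖v‖

variable {Q : ℕ → E →L[ℝ] E} {𝓕 : Set (Finset ℕ)} {B : ℝ}

theorem intervalSum_nonneg (s : Finset ℕ) (r : ℕ → ℕ) (v : E) : 0 ≤ intervalSum Q s r v :=
  Finset.sum_nonneg fun _ _ => norm_nonneg _

theorem HasBoundedVariation.mono {𝓖 : Set (Finset ℕ)} (h : HasBoundedVariation Q 𝓖 B)
    (h𝓕 : 𝓕 ⊆ 𝓖) : HasBoundedVariation Q 𝓕 B := fun s hs => h s (h𝓕 hs)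

theorem HasBoundedVariation.intervalSum_le_variation (h : HasBoundedVariation Q 𝓕 B)
    {s : Finset ℕ} (hs : s ∈ 𝓕) {r : ℕ → ℕ} (hr : IsIntervalSystem s r) (v : E) :
    intervalSum Q s r v ≤ variation Q 𝓕 v := by
  refine le_csSup ⟨B * ‖v‖, ?_⟩ ⟨s, hs, r, hr, rfl⟩
  rintro _ ⟨s, hs, r, hr, rfl⟩
  exact h s hs r hr v

theorem variation_nonneg (v : E) : 0 ≤ variation Q 𝓕 v := by
  refine Real.sSup_nonneg ?_
  rintro _ ⟨s, -, r, -, rfl⟩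
  exact intervalSum_nonneg s r v

theorem variation_le {A : ℝ} (hA : 0 ≤ A) {v : E}
    (h : ∀ s ∈ 𝓕, ∀ r, IsIntervalSystem s r → intervalSum Q s r v ≤ A) : variation Q 𝓕 v ≤ A := by
  refine Real.sSup_le ?_ hA
  rintro _ ⟨s, hs, r, hr, rfl⟩
  exact h s hs r hr

theorem HasBoundedVariation.variation_add_le (h : HasBoundedVariation Q 𝓕 B) (u v : E) :
    variation Q 𝓕 (u + v) ≤ variation Q 𝓕 u + variation Q 𝓕 v := by
  refine variation_le (add_nonneg (variation_nonneg _) (variation_nonneg _)) fun s hs r hr => ?_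
  refine le_trans ?_ (add_le_add (h.intervalSum_le_variation hs hr u)
    (h.intervalSum_le_variation hs hr v))
  simp only [intervalSum]
  rw [← Finset.sum_add_distrib]
  refine Finset.sum_le_sum fun l _ => ?_
  rw [map_add, map_add, add_sub_add_comm]
  exact norm_add_le _ _

theorem intervalSum_smul (s : Finset ℕ) (r : ℕ → ℕ) (a : ℝ) (v : E) :
    intervalSum Q s r (a • v) = ‖a‖ * intervalSum Q s r v := by
  simp only [intervalSum, map_smul, ← smul_sub, norm_smul, Finset.mul_sum]

theorem HasBoundedVariation.variation_smul_le (h : HasBoundedVariation Q 𝓕 B) (a : ℝ) (v : E) :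
    variation Q 𝓕 (a • v) ≤ ‖a‖ * variation Q 𝓕 v := by
  refine variation_le (mul_nonneg (norm_nonneg _) (variation_nonneg _)) fun s hs r hr => ?_
  rw [intervalSum_smul]
  exact mul_le_mul_of_nonneg_left (h.intervalSum_le_variation hs hr v) (norm_nonneg _)

theorem exists_variation_lt (h𝓕 : ∅ ∈ 𝓕) (v : E) {ε : ℝ} (hε : 0 < ε) :
    ∃ s ∈ 𝓕, ∃ r, IsIntervalSystem s r ∧ variation Q 𝓕 v < intervalSum Q s r v + ε := by
  have hne : {t | ∃ s ∈ 𝓕, ∃ r, IsIntervalSystem s r ∧ t = intervalSum Q s r v}.Nonempty :=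
    ⟨_, ∅, h𝓕, id, fun l hl => absurd hl (Finset.notMem_empty l), rfl⟩
  obtain ⟨_, ⟨s, hs, r, hr, rfl⟩, hlt⟩ := exists_lt_of_lt_csSup hne (sub_lt_self _ hε)
  exact ⟨s, hs, r, hr, sub_lt_iff_lt_add.1 hlt⟩

end

namespace IsBasisProjection

variable {E : Type*} [NormedAddCommGroup E] [NormedSpace ℝ E] {x : ℕ → E} {Q : ℕ → E →L[ℝ] E}
  {K : ℝ}

theorem sub_apply_eq_filter (h : IsBasisProjection x Q K) {l r : ℕ} (hlr : l ≤ r) (c : ℕ →₀ ℝ) :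
    Q r (blockVec x c) - Q l (blockVec x c) = blockVec x (c.filter fun k => l ≤ k ∧ k < r) := by
  rw [h.apply_blockVec, h.apply_blockVec, sub_eq_iff_eq_add, ← blockVec_add]
  congr 1
  ext k
  simp only [Finsupp.filter_apply, Finsupp.add_apply]
  split_ifs <;> first | omega | simp

/-- Interval systems for the members of a block family combine to one interval system for
the sum of the blocks. -/
theorem exists_combined_system (h : IsBasisProjection x Q K) {𝓕 𝓖 : Set (Finset ℕ)}
    (h𝓕 : IsRegularFamily 𝓕) (h𝓖 : IsRegularFamily 𝓖) {t : Finset ℕ} (ht : t ∈ 𝓕)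
    {b : ℕ → (ℕ →₀ ℝ)} (hb : IsBlockFamily t b) {s : ℕ → Finset ℕ} {r : ℕ → ℕ → ℕ}
    (hs : ∀ m ∈ t, s m ∈ 𝓖) (hr : ∀ m ∈ t, IsIntervalSystem (s m) (r m)) :
    ∃ s' ∈ famComp 𝓕 𝓖, ∃ r', IsIntervalSystem s' r' ∧
      ∑ m ∈ t, intervalSum Q (s m) (r m) (blockVec x (b m)) =
        intervalSum Q s' r' (∑ m ∈ t, blockVec x (b m)) := by
  classical
  -- The `m`-th block lives on `[m, M m)`, and these windows are disjoint.
  let M : ℕ → ℕ := fun m => max m ((b m).support.sup (· + 1))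
  have hM : ∀ m ∈ t, ∀ m' ∈ t, m < m' → M m ≤ m' := by
    intro m hm m' hm' hlt
    exact max_le hlt.le (Finset.sup_le fun k hk => (hb m hm k hk).2 m' hm' hlt)
  have hbM : ∀ m ∈ t, ∀ k, b m k ≠ 0 → m ≤ k ∧ k < M m := by
    intro m hm k hk
    have hk' := Finsupp.mem_support_iff.2 hk
    exact ⟨(hb m hm k hk').1, (Nat.lt_succ_self k).trans_le
      ((Finset.le_sup (f := (· + 1)) hk').trans (le_max_right _ _))⟩
  -- Each interval is intersected with the window of its block, which leaves its projection of that
  -- block unchanged; empty intersections are dropped.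
  let lo : (Σ _ : ℕ, ℕ) → ℕ := fun q => max q.2 q.1
  let hi : (Σ _ : ℕ, ℕ) → ℕ := fun q => min (r q.1 q.2) (M q.1)
  let T : Finset (Σ _ : ℕ, ℕ) := (t.sigma s).filter fun q => lo q < hi q
  have hT : ∀ q, q ∈ T ↔ (q.1 ∈ t ∧ q.2 ∈ s q.1) ∧ lo q < hi q := fun q => by
    rw [Finset.mem_filter, Finset.mem_sigma]
  have hlt : ∀ q ∈ T, ∀ q' ∈ T, (q.1 < q'.1 ∨ q.1 = q'.1 ∧ q.2 < q'.2) → hi q ≤ lo q' := by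
    rintro ⟨m, l⟩ hq ⟨m', l'⟩ hq' (h1 | ⟨rfl, h1⟩)
    · exact (min_le_right _ _).trans ((hM m ((hT _).1 hq).1.1 m' ((hT _).1 hq').1.1 h1).trans
        (le_max_right _ _))
    · exact (min_le_left _ _).trans (((hr m ((hT _).1 hq).1.1 l ((hT _).1 hq).1.2).2 l'
        ((hT _).1 hq').1.2 h1).trans (le_max_left _ _))
  have htri : ∀ q q' : (Σ _ : ℕ, ℕ), (q.1 < q'.1 ∨ q.1 = q'.1 ∧ q.2 < q'.2) ∨ q = q' ∨
      (q'.1 < q.1 ∨ q'.1 = q.1 ∧ q'.2 < q.2) := by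
    rintro ⟨m, l⟩ ⟨m', l'⟩
    rcases lt_trichotomy m m' with h1 | rfl | h1
    · exact Or.inl (Or.inl h1)
    · rcases lt_trichotomy l l' with h2 | rfl | h2
      · exact Or.inl (Or.inr ⟨rfl, h2⟩)
      · exact Or.inr (Or.inl rfl)
      · exact Or.inr (Or.inr (Or.inr ⟨rfl, h2⟩))
    · exact Or.inr (Or.inr (Or.inl h1))
  have hlohi : ∀ q ∈ T, lo q < hi q := fun q hq => ((hT q).1 hq).2
  have hinj : Set.InjOn lo T := by
    intro q hq q' hq' heq
    rcases htri q q' with h1 | h1 | h1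
    · have := hlt q hq q' hq' h1
      have := hlohi q hq
      omega
    · exact h1
    · have := hlt q' hq' q hq h1
      have := hlohi q' hq'
      omega
  let inv := Function.invFunOn lo (T : Set (Σ _ : ℕ, ℕ))
  have hinv : ∀ q ∈ T, inv (lo q) = q := fun q hq => hinj.leftInvOn_invFunOn hq
  refine ⟨T.image lo, ?_, fun c => hi (inv c), ?_, ?_⟩
  · have himage : (T.image lo).image (fun c => (inv c).1) ⊆ t := by
      intro m hm
      obtain ⟨c, hc, rfl⟩ := Finset.mem_image.1 hm
      obtain ⟨q, hq, rfl⟩ := Finset.mem_image.1 hc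
      rw [hinv q hq]
      exact ((hT q).1 hq).1.1
    -- An interval is labelled by its block. Truncation only moves left end points to the right, so
    -- each fibre is a spread of a subset of the original `s m`.
    refine mem_famComp_of_label h𝓕 (fun c => (inv c).1) ?_ ?_ (h𝓕.hereditary _ ht _ himage) ?_
    · intro c hc
      obtain ⟨q, hq, rfl⟩ := Finset.mem_image.1 hc
      rw [hinv q hq]
      exact le_max_right _ _
    · intro c hc c' hc' hcc
      obtain ⟨q, hq, rfl⟩ := Finset.mem_image.1 (Finset.mem_coe.1 hc)
      obtain ⟨q', hq', rfl⟩ := Finset.mem_image.1 (Finset.mem_coe.1 hc')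
      simp only [hinv q hq, hinv q' hq']
      by_contra hcon
      have := hlt q' hq' q hq (Or.inl (not_le.1 hcon))
      have := hlohi q' hq'
      omega
    · intro m hm
      have hmt := himage hm
      have hfib : (T.image lo).filter (fun c => (inv c).1 = m) =
          ((s m).filter fun l => lo ⟨m, l⟩ < hi ⟨m, l⟩).image fun l => lo ⟨m, l⟩ := by
        ext c
        simp only [Finset.mem_filter, Finset.mem_image]
        constructor
        · rintro ⟨⟨⟨m', l⟩, hq, rfl⟩, h1⟩
          rw [hinv _ hq] at h1
          subst h1
          exact ⟨l, ⟨((hT _).1 hq).1.2, hlohi _ hq⟩, rfl⟩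
        · rintro ⟨l, ⟨hl, h1⟩, rfl⟩
          have hq : (⟨m, l⟩ : Σ _ : ℕ, ℕ) ∈ T := (hT _).2 ⟨⟨hmt, hl⟩, h1⟩
          exact ⟨⟨_, hq, rfl⟩, by rw [hinv _ hq]⟩
      rw [hfib]
      refine h𝓖.spreading _ (h𝓖.hereditary _ (hs m hmt) _ (Finset.filter_subset _ _)) _ ?_
        fun l _ => le_max_left _ _
      intro l hl l' hl' hll
      have h1 := Finset.mem_filter.1 (Finset.mem_coe.1 hl)
      have h2 := Finset.mem_filter.1 (Finset.mem_coe.1 hl')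
      have hq : (⟨m, l⟩ : Σ _ : ℕ, ℕ) ∈ T := (hT _).2 ⟨⟨hmt, h1.1⟩, h1.2⟩
      have hq' : (⟨m, l'⟩ : Σ _ : ℕ, ℕ) ∈ T := (hT _).2 ⟨⟨hmt, h2.1⟩, h2.2⟩
      exact h1.2.trans_le (hlt _ hq _ hq' (Or.inr ⟨rfl, hll⟩))
  · intro c hc
    obtain ⟨q, hq, rfl⟩ := Finset.mem_image.1 hc
    simp only [hinv q hq]
    refine ⟨hlohi q hq, fun c' hc' hcc => ?_⟩
    obtain ⟨q', hq', rfl⟩ := Finset.mem_image.1 hc'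
    rcases htri q q' with h1 | rfl | h1
    · exact hlt q hq q' hq' h1
    · exact absurd hcc (lt_irrefl _)
    · have := hlt q' hq' q hq h1
      have := hlohi q' hq'
      omega
  · have hsum : ∑ m ∈ t, blockVec x (b m) = blockVec x (∑ m ∈ t, b m) := (map_sum _ _ _).symm
    have hother : ∀ m ∈ t, ∀ k, m ≤ k → k < M m → (∑ m' ∈ t, b m') k = b m k := by
      intro m hm k h1 h2
      rw [Finsupp.finsetSum_apply]
      refine Finset.sum_eq_single m (fun m' hm' hne => ?_) fun hcon => absurd hm hcon
      by_contra hcon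
      have h3 := hbM m' hm' k hcon
      rcases lt_or_gt_of_ne hne with h4 | h4
      · have := hM m' hm' m hm h4
        omega
      · have := hM m hm m' hm' h4
        omega
    have hval : ∀ q ∈ t.sigma s, ‖Q (r q.1 q.2) (blockVec x (b q.1)) -
        Q q.2 (blockVec x (b q.1))‖ = if lo q < hi q then
          ‖Q (hi q) (blockVec x (∑ m ∈ t, b m)) - Q (lo q) (blockVec x (∑ m ∈ t, b m))‖
        else 0 := by
      rintro ⟨m, l⟩ hq
      obtain ⟨hm, hl⟩ := Finset.mem_sigma.1 hq
      have hlr := ((hr m hm) l hl).1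
      rw [h.sub_apply_eq_filter hlr.le]
      have hrange : ∀ k, b m k ≠ 0 → ((l ≤ k ∧ k < r m l) ↔ (lo ⟨m, l⟩ ≤ k ∧ k < hi ⟨m, l⟩)) := by
        intro k hk
        have := hbM m hm k hk
        simp only [lo, hi, max_le_iff, lt_min_iff]
        tauto
      split_ifs with hlh
      · rw [h.sub_apply_eq_filter hlh.le]
        congr 2
        ext k
        simp only [Finsupp.filter_apply]
        by_cases hk : lo ⟨m, l⟩ ≤ k ∧ k < hi ⟨m, l⟩
        · rw [if_pos hk, hother m hm k ((le_max_right _ _).trans hk.1)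
            (hk.2.trans_le (min_le_right _ _))]
          by_cases h0 : b m k = 0
          · simp [h0]
          · rw [if_pos ((hrange k h0).2 hk)]
        · rw [if_neg hk]
          by_cases h0 : b m k = 0
          · simp [h0]
          · rw [if_neg fun h1 => hk ((hrange k h0).1 h1)]
      · rw [(Finsupp.filter_eq_zero_iff _ _).2, blockVec_zero, norm_zero]
        intro k hk
        by_contra h0
        have := (hrange k h0).1 hk
        omega
    simp only [intervalSum]
    rw [Finset.sum_sigma' t s fun m l => ‖Q (r m l) (blockVec x (b m)) - Q l (blockVec x (b m))‖,
      Finset.sum_congr rfl hval, ← Finset.sum_filter, Finset.sum_image hinj, hsum]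
    exact Finset.sum_congr rfl fun q hq => by rw [hinv q hq]

/-- Interval systems that are optimal up to ε on each block combine to a system one level deeper for
the sum. -/
theorem sum_variation_le (h : IsBasisProjection x Q K) {𝓕 𝓖 : Set (Finset ℕ)}
    (h𝓕 : IsRegularFamily 𝓕) (h𝓖 : IsRegularFamily 𝓖) {t : Finset ℕ} (ht : t ∈ 𝓕)
    {b : ℕ → (ℕ →₀ ℝ)} (hb : IsBlockFamily t b) {A : ℝ}
    (hA : ∀ s ∈ famComp 𝓕 𝓖, ∀ r, IsIntervalSystem s r →
      intervalSum Q s r (∑ m ∈ t, blockVec x (b m)) ≤ A) :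
    ∑ m ∈ t, variation Q 𝓖 (blockVec x (b m)) ≤ A := by
  have hempty : ∅ ∈ 𝓖 := h𝓖.of_card_le_one _ (by simp)
  have key : ∀ ε > 0, ∑ m ∈ t, variation Q 𝓖 (blockVec x (b m)) ≤ A + t.card * ε := by
    intro ε hε
    choose s hs r hr hlt using fun m => exists_variation_lt (Q := Q) hempty (blockVec x (b m)) hε
    obtain ⟨s', hs', r', hr', heq⟩ :=
      h.exists_combined_system h𝓕 h𝓖 ht hb (fun m _ => hs m) fun m _ => hr m
    calc ∑ m ∈ t, variation Q 𝓖 (blockVec x (b m))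
        ≤ ∑ m ∈ t, (intervalSum Q (s m) (r m) (blockVec x (b m)) + ε) :=
          Finset.sum_le_sum fun m _ => (hlt m).le
      _ = intervalSum Q s' r' (∑ m ∈ t, blockVec x (b m)) + t.card * ε := by
          rw [Finset.sum_add_distrib, heq, Finset.sum_const, nsmul_eq_mul]
      _ ≤ A + t.card * ε := by linarith [hA s' hs' r' hr']
  refine le_of_forall_pos_le_add fun ε hε => ?_
  have hc : (0 : ℝ) < t.card + 1 := by positivity
  refine (key (ε / (t.card + 1)) (by positivity)).trans ?_
  have : (t.card : ℝ) * (ε / (t.card + 1)) ≤ ε := by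
    rw [mul_div_assoc', div_le_iff₀ hc]
    nlinarith
  linarith

/-- The bottom level of the same argument: each block is caught whole by a single interval starting
at 0. -/
theorem sum_norm_le (h : IsBasisProjection x Q K) {𝓕 𝓖 : Set (Finset ℕ)}
    (h𝓕 : IsRegularFamily 𝓕) (h𝓖 : IsRegularFamily 𝓖) {t : Finset ℕ} (ht : t ∈ 𝓕)
    {b : ℕ → (ℕ →₀ ℝ)} (hb : IsBlockFamily t b) {A : ℝ}
    (hA : ∀ s ∈ famComp 𝓕 𝓖, ∀ r, IsIntervalSystem s r →
      intervalSum Q s r (∑ m ∈ t, blockVec x (b m)) ≤ A) :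
    ∑ m ∈ t, ‖blockVec x (b m)‖ ≤ A := by
  obtain ⟨s', hs', r', hr', heq⟩ := h.exists_combined_system h𝓕 h𝓖 ht hb
    (s := fun _ => {0}) (r := fun m _ => (b m).support.sup id + 1)
    (fun m _ => h𝓖.of_card_le_one _ (by simp)) fun m _ l hl => by
      rw [Finset.mem_singleton] at hl
      subst hl
      exact ⟨Nat.succ_pos _, fun l' hl' hlt => by
        rw [Finset.mem_singleton] at hl'
        omega⟩
  have heach : ∀ m, intervalSum Q {0} (fun _ => (b m).support.sup id + 1) (blockVec x (b m)) =
      ‖blockVec x (b m)‖ := by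
    intro m
    simp only [intervalSum, Finset.sum_singleton]
    rw [h.sub_apply_eq_filter (Nat.zero_le _), (Finsupp.filter_eq_self_iff _ _).2]
    intro k hk
    exact ⟨k.zero_le, Nat.lt_succ_of_le (Finset.le_sup (f := id) (Finsupp.mem_support_iff.2 hk))⟩
  rw [← Finset.sum_congr rfl fun m _ => heach m, heq]
  exact hA s' hs' r' hr'

/-- The renorming: if interval systems with left end points in the `n`-fold composition of `𝓕` are
bounded by `θ ^ (-n)`, then some equivalent norm has lower estimate `θ` for `𝓕`. -/
theorem exists_isEquivNorm_hasLowerEstimate (h : IsBasisProjection x Q K)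
    {𝓕 : Set (Finset ℕ)} (h𝓕 : IsRegularFamily 𝓕) {n : ℕ} {θ B : ℝ} (hθ : 0 < θ)
    (hθB : θ ^ (n + 1) * B ≤ 1) (hB0 : 0 ≤ B)
    (hB : HasBoundedVariation Q (famPow 𝓕 (n + 1)) B) :
    ∃ p : Seminorm ℝ E, IsEquivNorm p ∧ HasLowerEstimate 𝓕 p x θ := by
  let q : ℕ → E → ℝ := fun k v => if k = 0 then ‖v‖ else variation Q (famPow 𝓕 k) v
  have hq0 : ∀ v, q 0 v = ‖v‖ := fun v => if_pos rfl
  have hqs : ∀ k v, q (k + 1) v = variation Q (famPow 𝓕 (k + 1)) v := fun k v =>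
    if_neg (Nat.succ_ne_zero k)
  have hBk : ∀ k ≤ n, HasBoundedVariation Q (famPow 𝓕 (k + 1)) B := fun k hk =>
    hB.mono (famPow_mono h𝓕 (by omega))
  have hqnn : ∀ k v, 0 ≤ q k v := by
    rintro (_ | k) v
    · rw [hq0]; exact norm_nonneg v
    · rw [hqs]; exact variation_nonneg v
  have hqadd : ∀ k ≤ n, ∀ u v, q k (u + v) ≤ q k u + q k v := by
    rintro (_ | k) hk u v
    · simp only [hq0]; exact norm_add_le u v
    · simp only [hqs]; exact (hBk k (by omega)).variation_add_le u v
  have hqsmul : ∀ k ≤ n, ∀ (a : ℝ) v, q k (a • v) ≤ ‖a‖ * q k v := by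
    rintro (_ | k) hk a v
    · simp only [hq0]; exact (norm_smul a v).le
    · simp only [hqs]; exact (hBk k (by omega)).variation_smul_le a v
  have hqle : ∀ k ≤ n, ∀ v, q k v ≤ (B + 1) * ‖v‖ := by
    rintro (_ | k) hk v
    · rw [hq0]; nlinarith [norm_nonneg v]
    · rw [hqs]
      have := norm_nonneg v
      refine variation_le (by positivity) fun s hs r hr => ?_
      have := hBk k (by omega) s hs r hr v
      linarith
  -- Summing level `k` over an `𝓕`-family of blocks is controlled by level `k + 1` of the sum.
  have hstep : ∀ k, ∀ t ∈ 𝓕, ∀ b, IsBlockFamily t b → ∀ A,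
      (∀ s ∈ famPow 𝓕 (k + 1), ∀ r, IsIntervalSystem s r →
        intervalSum Q s r (∑ m ∈ t, blockVec x (b m)) ≤ A) →
      ∑ m ∈ t, q k (blockVec x (b m)) ≤ A := by
    rintro (_ | k) t ht b hb A hA
    · simp only [hq0]
      exact h.sum_norm_le h𝓕 (h𝓕.famPow 0) ht hb hA
    · simp only [hqs]
      exact h.sum_variation_le h𝓕 (h𝓕.famPow (k + 1)) ht hb hA
  have hmem : ∀ k ∈ Finset.range (n + 1), k ≤ n := fun k hk =>
    Nat.lt_succ_iff.1 (Finset.mem_range.1 hk)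
  let p : Seminorm ℝ E := Seminorm.ofSMulLE (fun v => ∑ k ∈ Finset.range (n + 1), θ ^ k * q k v)
    (by
      refine Finset.sum_eq_zero fun k hk => ?_
      have h1 := hqle k (hmem k hk) 0
      rw [norm_zero, mul_zero] at h1
      rw [le_antisymm h1 (hqnn k 0), mul_zero])
    (fun u v => by
      rw [← Finset.sum_add_distrib]
      refine Finset.sum_le_sum fun k hk => ?_
      rw [← mul_add]
      exact mul_le_mul_of_nonneg_left (hqadd k (hmem k hk) u v) (by positivity))
    (fun a v => by
      rw [Finset.mul_sum]
      refine Finset.sum_le_sum fun k hk => ?_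
      rw [mul_left_comm]
      exact mul_le_mul_of_nonneg_left (hqsmul k (hmem k hk) a v) (by positivity))
  have hp : ∀ v, p v = ∑ k ∈ Finset.range (n + 1), θ ^ k * q k v := fun v => rfl
  refine ⟨p, ⟨1, ∑ k ∈ Finset.range (n + 1), θ ^ k * (B + 1), one_pos, ?_, fun v => ⟨?_, ?_⟩⟩, ?_⟩
  · exact Finset.sum_pos (fun k _ => by positivity) ⟨0, by simp⟩
  · rw [hp, one_mul, ← hq0]
    refine le_trans (by simp) (Finset.single_le_sum (f := fun k => θ ^ k * q k v)
      (fun k _ => mul_nonneg (by positivity) (hqnn k v)) (Finset.mem_range.2 (Nat.succ_pos n)))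
  · rw [hp, Finset.sum_mul]
    refine Finset.sum_le_sum fun k hk => ?_
    rw [mul_assoc]
    exact mul_le_mul_of_nonneg_left (hqle k (hmem k hk) v) (by positivity)
  · intro t ht b hb
    set U := ∑ m ∈ t, blockVec x (b m) with hU
    have htop : θ ^ (n + 1) * ∑ m ∈ t, q n (blockVec x (b m)) ≤ ‖U‖ := by
      have h1 := hstep n t ht b hb (B * ‖U‖) fun s hs r hr => hB s hs r hr U
      calc θ ^ (n + 1) * ∑ m ∈ t, q n (blockVec x (b m)) ≤ θ ^ (n + 1) * (B * ‖U‖) :=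
            mul_le_mul_of_nonneg_left h1 (by positivity)
        _ = θ ^ (n + 1) * B * ‖U‖ := by ring
        _ ≤ 1 * ‖U‖ := mul_le_mul_of_nonneg_right hθB (norm_nonneg U)
        _ = ‖U‖ := one_mul _
    have hmid : ∀ k ∈ Finset.range n, ∑ m ∈ t, q k (blockVec x (b m)) ≤ q (k + 1) U := by
      intro k hk
      rw [hqs]
      exact hstep k t ht b hb _ fun s hs r hr =>
        (hBk k (Finset.mem_range.1 hk).le).intervalSum_le_variation hs hr U
    -- The factor θ raises each level by one: level `k` is compared with the term `k + 1` of `p U`,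
    -- and the top level returns to the term `‖U‖` through the bound `B`.
    have hsplit : θ * ∑ m ∈ t, p (blockVec x (b m)) =
        ∑ k ∈ Finset.range n, θ ^ (k + 1) * ∑ m ∈ t, q k (blockVec x (b m)) +
          θ ^ (n + 1) * ∑ m ∈ t, q n (blockVec x (b m)) := by
      simp only [hp]
      rw [Finset.sum_comm, ← Finset.sum_range_succ
        (fun k => θ ^ (k + 1) * ∑ m ∈ t, q k (blockVec x (b m))), Finset.mul_sum]
      refine Finset.sum_congr rfl fun k _ => ?_
      rw [← Finset.mul_sum, pow_succ]
      ring
    rw [hsplit, hp, Finset.sum_range_succ', pow_zero, one_mul, hq0]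
    exact add_le_add (Finset.sum_le_sum fun k hk =>
      mul_le_mul_of_nonneg_left (hmid k hk) (by positivity)) htop

end IsBasisProjection

/-! ### Bounded variation from lower estimates -/

section

variable {E : Type*} [NormedAddCommGroup E] [NormedSpace ℝ E]

/-- The operators still act on all of `E`, so a renorming built from them is a norm on the whole
space while its estimate concerns the subsequence. -/
theorem IsBasisProjection.comp {y : ℕ → E} {Q : ℕ → E →L[ℝ] E} {K : ℝ}
    (h : IsBasisProjection y Q K) {g : ℕ → ℕ} (hg : StrictMono g) :
    IsBasisProjection (fun i => y (g i)) (fun k => Q (g k)) K where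
  ne_zero i := h.ne_zero _
  norm_le k := h.norm_le _
  apply_eq k i := by rw [h.apply_eq]; simp only [hg.lt_iff_lt]

theorem IsBasisProjection.intervalSum_blockVec_le {y : ℕ → E} {Q : ℕ → E →L[ℝ] E} {K : ℝ}
    (h : IsBasisProjection y Q K) {g : ℕ → ℕ} (hg : StrictMono g) {𝓖 : Set (Finset ℕ)} {δ : ℝ}
    (hδ : 0 < δ) (hlow : HasLowerEstimate 𝓖 (normSeminorm ℝ E) y δ) {s : Finset ℕ}
    (hs : s.image g ∈ 𝓖) {r : ℕ → ℕ} (hr : IsIntervalSystem s r) (c : ℕ →₀ ℝ) :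
    intervalSum (fun k => Q (g k)) s r (blockVec y c) ≤ K * (1 + K) / δ * ‖blockVec y c‖ := by
  classical
  have hK := h.one_le
  rcases s.eq_empty_or_nonempty with rfl | hne
  · simp only [intervalSum, Finset.sum_empty]
    positivity
  -- `c` is cut at all left end points. Shortening each piece to its interval costs a factor `K`,
  -- and the pieces add up to `c` without an initial segment, which costs `1 + K`.
  let b : ℕ → (ℕ →₀ ℝ) := fun l => c.filter fun k => g l ≤ k ∧ ∀ l' ∈ s, l < l' → k < g l'
  let b' : ℕ → (ℕ →₀ ℝ) := Function.extend g b 0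
  have hb' : ∀ l, b' (g l) = b l := fun l => hg.injective.extend_apply _ _ _
  have hfam : IsBlockFamily (s.image g) b' := by
    intro m hm k hk
    obtain ⟨l, hl, rfl⟩ := Finset.mem_image.1 hm
    rw [hb', Finsupp.support_filter, Finset.mem_filter] at hk
    refine ⟨hk.2.1, fun m' hm' hlt => ?_⟩
    obtain ⟨l', hl', rfl⟩ := Finset.mem_image.1 hm'
    exact hk.2.2 l' hl' (hg.lt_iff_lt.1 hlt)
  have h1 := hlow _ hs b' hfam
  rw [Finset.sum_image hg.injective.injOn, Finset.sum_image hg.injective.injOn] at h1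
  simp only [hb', coe_normSeminorm] at h1
  have htotal : ∑ l ∈ s, b l = c.filter fun k => ¬ k < g (s.min' hne) := by
    ext k
    rw [Finsupp.finsetSum_apply]
    simp only [b, Finsupp.filter_apply]
    split_ifs with hk
    · refine Finset.sum_eq_zero fun l hl => if_neg fun hcon => ?_
      have := hg.monotone (Finset.min'_le s l hl)
      omega
    · let u := s.filter fun l => g l ≤ k
      have hu : u.Nonempty := ⟨s.min' hne, by simp [u, Finset.min'_mem, not_lt.1 hk]⟩
      have hmax := Finset.mem_filter.1 (u.max'_mem hu)
      rw [Finset.sum_eq_single (u.max' hu), if_pos]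
      · refine ⟨hmax.2, fun l' hl' hlt => ?_⟩
        by_contra hcon
        have := u.le_max' l' (Finset.mem_filter.2 ⟨hl', not_lt.1 hcon⟩)
        omega
      · intro l hl hlne
        refine if_neg fun hcon => hlne (le_antisymm ?_ ?_)
        · exact u.le_max' l (Finset.mem_filter.2 ⟨hl, hcon.1⟩)
        · by_contra hlt
          have := hcon.2 _ hmax.1 (not_le.1 hlt)
          omega
      · exact fun hcon => absurd hmax.1 hcon
  have h2 : ‖∑ l ∈ s, blockVec y (b l)‖ ≤ (1 + K) * ‖blockVec y c‖ := by
    have h3 : ∑ l ∈ s, blockVec y (b l) = blockVec y c - Q (g (s.min' hne)) (blockVec y c) := by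
      rw [h.apply_blockVec, eq_sub_iff_add_eq, ← map_sum, htotal, ← blockVec_add, add_comm,
        Finsupp.filter_add_filter_not]
    rw [h3]
    refine (norm_sub_le _ _).trans ?_
    linarith [h.norm_le (g (s.min' hne)) (blockVec y c)]
  have h4 : ∀ l ∈ s, ‖Q (g (r l)) (blockVec y c) - Q (g l) (blockVec y c)‖ ≤
      K * ‖blockVec y (b l)‖ := by
    intro l hl
    have hlr := hr l hl
    have h5 : Q (g (r l)) (blockVec y c) - Q (g l) (blockVec y c) =
        Q (g (r l)) (blockVec y (b l)) := by
      rw [h.sub_apply_eq_filter (hg hlr.1).le, h.apply_blockVec]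
      congr 1
      ext k
      simp only [b, Finsupp.filter_apply]
      by_cases hk : k < g (r l)
      · have hk' : ∀ l' ∈ s, l < l' → k < g l' := fun l' hl' hlt =>
          hk.trans_le (hg.monotone (hlr.2 l' hl' hlt))
        simp only [hk, and_true, if_true, and_iff_left (show ∀ l' ∈ s, l < l' → k < g l' from hk')]
      · simp [hk]
    rw [h5]
    exact h.norm_le _ _
  calc intervalSum (fun k => Q (g k)) s r (blockVec y c)
      ≤ ∑ l ∈ s, K * ‖blockVec y (b l)‖ := Finset.sum_le_sum h4
    _ = K / δ * (δ * ∑ l ∈ s, ‖blockVec y (b l)‖) := by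
        rw [← Finset.mul_sum]
        field_simp
    _ ≤ K / δ * ((1 + K) * ‖blockVec y c‖) :=
        mul_le_mul_of_nonneg_left (h1.trans h2) (by positivity)
    _ = K * (1 + K) / δ * ‖blockVec y c‖ := by ring

theorem IsBasisProjection.hasBoundedVariation {y : ℕ → E} {Q : ℕ → E →L[ℝ] E} {K : ℝ}
    (h : IsBasisProjection y Q K) (hdense : ∀ v, v ∈ closure (Set.range (blockVec y)))
    {g : ℕ → ℕ} (hg : StrictMono g) {𝓕 𝓖 : Set (Finset ℕ)} {δ : ℝ}
    (hδ : 0 < δ) (hlow : HasLowerEstimate 𝓖 (normSeminorm ℝ E) y δ)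
    (h𝓕 : ∀ F ∈ 𝓕, F.image g ∈ 𝓖) :
    HasBoundedVariation (fun k => Q (g k)) 𝓕 (K * (1 + K) / δ) := by
  intro s hs r hr v
  have hclosed : IsClosed {v | intervalSum (fun k => Q (g k)) s r v ≤
      K * (1 + K) / δ * ‖v‖} := by
    refine isClosed_le ?_ (by fun_prop)
    unfold intervalSum
    fun_prop
  refine closure_minimal ?_ hclosed (hdense v)
  rintro _ ⟨c, rfl⟩
  exact h.intervalSum_blockVec_le hg hδ hlow (h𝓕 s hs) hr c

end

theorem blockVec_eq_blockVec_tail {X : Type*} [AddCommGroup X] [Module ℝ X] (y : ℕ → X) {N : ℕ}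
    {c : ℕ →₀ ℝ} (hc : ∀ k ∈ c.support, N ≤ k) :
    blockVec y c = blockVec (fun i => y (N + i))
      (c.comapDomain (fun i => N + i) (strictMono_const_add N).injective.injOn) := by
  have hmap := Finsupp.mapDomain_comapDomain (fun i => N + i) (strictMono_const_add N).injective c
    fun k hk => ⟨k - N, by have := hc k hk; simp only; omega⟩
  have := Finsupp.linearCombination_mapDomain ℝ (v' := y) (fun i => N + i)
    (c.comapDomain (fun i => N + i) (strictMono_const_add N).injective.injOn)
  rwa [hmap] at this

/-- The renorming takes place on the span of all of `y`, so an estimate known only on a tail is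
restated for `y` with shifted markers. -/
theorem HasLowerEstimate.of_tail {X : Type*} [AddCommGroup X] [Module ℝ X]
    {𝓕 : Set (Finset ℕ)} {p : Seminorm ℝ X} {y : ℕ → X} {δ : ℝ} {N : ℕ}
    (h : HasLowerEstimate 𝓕 p (fun i => y (N + i)) δ) :
    HasLowerEstimate (Set.image (fun F => F.image fun i => N + i) 𝓕) p y δ := by
  rintro _ ⟨s, hs, rfl⟩ b hb
  have hinj : Function.Injective fun i => N + i := (strictMono_const_add N).injective
  have heq : ∀ m ∈ s, blockVec y (b (N + m)) = blockVec (fun i => y (N + i))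
      ((b (N + m)).comapDomain (fun i => N + i) hinj.injOn) := fun m hm =>
    blockVec_eq_blockVec_tail y fun k hk =>
      (Nat.le_add_right N m).trans (hb _ (Finset.mem_image_of_mem _ hm) k hk).1
  rw [Finset.sum_image hinj.injOn, Finset.sum_image hinj.injOn, Finset.sum_congr rfl heq,
    Finset.sum_congr rfl fun m hm => congrArg p (heq m hm)]
  refine h s hs _ fun m hm k hk => ?_
  rw [Finsupp.comapDomain_support, Finset.mem_preimage] at hk
  have h1 := hb _ (Finset.mem_image_of_mem _ hm) _ hk
  refine ⟨by omega, fun m' hm' hlt => ?_⟩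
  have := h1.2 _ (Finset.mem_image_of_mem _ hm') (by omega)
  omega

theorem HasLowerEstimate.famPow {X : Type*} [AddCommGroup X] [Module ℝ X]
    {𝓕 : Set (Finset ℕ)} {p : Seminorm ℝ X} {x : ℕ → X} {δ : ℝ} (hδ : 0 ≤ δ)
    (h : HasLowerEstimate 𝓕 p x δ) (n : ℕ) : HasLowerEstimate (famPow 𝓕 n) p x (δ ^ n) := by
  induction n with
  | zero =>
    intro s hs b _
    rcases Finset.card_le_one_iff_subset_singleton.1 hs with ⟨m, hm⟩
    rcases Finset.subset_singleton_iff.1 hm with rfl | rfl <;> simp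
  | succ n ih => rw [pow_succ']; exact h.famComp hδ ih

/-! ### Passage to the closed span -/

section

variable {X : Type*} [NormedAddCommGroup X] [NormedSpace ℝ X] {y : ℕ → X}

theorem coe_blockVec {V : Submodule ℝ X} (z : ℕ → V) (c : ℕ →₀ ℝ) :
    ((blockVec z c : V) : X) = blockVec (fun i => (z i : X)) c := by
  simp [blockVec, Finsupp.linearCombination_apply, Finsupp.sum]

theorem IsBlockBasis.coe {V : Submodule ℝ X} {z x : ℕ → V} (h : IsBlockBasis z x) :
    IsBlockBasis (fun i => (z i : X)) (fun i => (x i : X)) := by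
  obtain ⟨a, ha, hz⟩ := h
  exact ⟨a, ha, fun i => (congrArg Subtype.val (hz i)).trans (coe_blockVec _ _)⟩

theorem hasLowerEstimate_coe_iff {V : Submodule ℝ X} {z : ℕ → V} {𝓕 : Set (Finset ℕ)} {δ : ℝ} :
    HasLowerEstimate 𝓕 (normSeminorm ℝ X) (fun i => (z i : X)) δ ↔
      HasLowerEstimate 𝓕 (normSeminorm ℝ V) z δ := by
  simp only [HasLowerEstimate, coe_normSeminorm, Submodule.coe_norm, Submodule.coe_sum,
    coe_blockVec]

theorem mem_closure_range_blockVec_inClosedSpan (v : closedSpan y) :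
    v ∈ closure (Set.range (blockVec (inClosedSpan y))) := by
  rw [Metric.mem_closure_iff]
  intro ε hε
  obtain ⟨u, hu, huv⟩ := Metric.mem_closure_iff.1 v.2 ε hε
  obtain ⟨c, rfl⟩ := (Finsupp.mem_span_range_iff_exists_finsupp).1 hu
  refine ⟨_, ⟨c, rfl⟩, ?_⟩
  rw [Subtype.dist_eq, coe_blockVec]
  exact huv

end

/-! ### The constants of a stabilizing sequence -/

namespace DeltaStabilizes

variable {X : Type*} [NormedAddCommGroup X] [NormedSpace ℝ X] {L : Ordinal.{0} → ℕ → Ordinal.{0}}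
  {y : ℕ → X} {γ : Ordinal.{0} → ℝ} {β : Ordinal.{0}}

/-- The estimate passes to the tails of `z`, which are block bases of the tails of `y`, where the
constant tends to `γ β`. -/
theorem le_of_hasLowerEstimate (hγ : DeltaStabilizes L y γ) (hL : IsLadderSystem L) (hβ : β < ω₁)
    {z : ℕ → X} (hz : IsBlockBasis z y) (hz0 : ∀ i, z i ≠ 0) {δ : ℝ} (hδ : 0 ≤ δ)
    (h : HasLowerEstimate (schreier L β) (normSeminorm ℝ X) z δ) : δ ≤ γ β := by
  obtain ⟨ε, -, hε, hstab⟩ := hγ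
  obtain ⟨m, hm⟩ := hstab β hβ
  have hlim : Tendsto (fun n => γ β + ε n) atTop (𝓝 (γ β)) := by
    simpa using hε.const_add (γ β)
  refine ge_of_tendsto hlim (eventually_atTop.2 ⟨m, fun n hn => ?_⟩)
  have hreg := isRegularFamily_schreier hL β hβ
  have h1 := (h.of_isBlockBasis hreg (isBlockBasis_comp z (strictMono_const_add n))).le_asympDelta
    hreg (i := 0) (by simpa using hz0 _) hδ
  have h2 := (abs_lt.1 (hm n hn _ (hz.tail n))).2
  linarith

theorem le_one (hγ : DeltaStabilizes L y γ) (hL : IsLadderSystem L) (hβ : β < ω₁)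
    (hy0 : ∀ i, y i ≠ 0) : γ β ≤ 1 := by
  obtain ⟨ε, -, hε, hstab⟩ := hγ
  obtain ⟨m, hm⟩ := hstab β hβ
  have hlim : Tendsto (fun n => 1 + ε n) atTop (𝓝 1) := by
    simpa using hε.const_add 1
  refine ge_of_tendsto hlim (eventually_atTop.2 ⟨m, fun n hn => ?_⟩)
  have h1 : asympDelta (schreier L β) (normSeminorm ℝ X) (fun i => y (n + i)) ≤ 1 :=
    asympDelta_le_one (isRegularFamily_schreier hL β hβ) (i := 0) (by simpa using hy0 _)
  have h2 := (abs_lt.1 (hm n hn _ (IsBlockBasis.refl _))).1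
  linarith

theorem nonneg (hγ : DeltaStabilizes L y γ) (hL : IsLadderSystem L) (hβ : β < ω₁)
    (hy0 : ∀ i, y i ≠ 0) : 0 ≤ γ β :=
  hγ.le_of_hasLowerEstimate hL hβ (IsBlockBasis.refl y) hy0 le_rfl hasLowerEstimate_zero

theorem exists_hasLowerEstimate (hγ : DeltaStabilizes L y γ) (hL : IsLadderSystem L)
    (hβ : β < ω₁) {δ : ℝ} (hδ : δ < γ β) :
    ∃ N, HasLowerEstimate (schreier L β) (normSeminorm ℝ X) (fun i => y (N + i)) δ := by
  obtain ⟨ε, -, hε, hstab⟩ := hγ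
  obtain ⟨m, hm⟩ := hstab β hβ
  obtain ⟨N, hN, hmN⟩ := ((hε.eventually (gt_mem_nhds (sub_pos.2 hδ))).and
    (eventually_ge_atTop m)).exists
  refine ⟨N, (hasLowerEstimate_asympDelta (isRegularFamily_schreier hL β hβ)).of_le ?_⟩
  have := (abs_lt.1 (hm N hmN _ (IsBlockBasis.refl _))).1
  linarith

theorem mul_le_add {α : Ordinal.{0}} (hγ : DeltaStabilizes L y γ) (hL : IsLadderSystem L)
    (hα : α < ω₁) (hβ : β < ω₁) (hy0 : ∀ i, y i ≠ 0) : γ α * γ β ≤ γ (α + β) := by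
  refine mul_le_of_forall_lt_of_nonneg (hγ.nonneg hL hα hy0)
    (hγ.nonneg hL (add_lt_omega_one hα hβ) hy0) fun δ hδ hδα ε hε hεβ => ?_
  obtain ⟨N₁, h₁⟩ := hγ.exists_hasLowerEstimate hL hα hδα
  obtain ⟨N₂, h₂⟩ := hγ.exists_hasLowerEstimate hL hβ hεβ
  have h₁' := h₁.of_isBlockBasis (isRegularFamily_schreier hL α hα)
    (isBlockBasis_comp _ (strictMono_const_add N₂))
  have h₂' := h₂.of_isBlockBasis (isRegularFamily_schreier hL β hβ)
    (isBlockBasis_comp _ (strictMono_const_add N₁))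
  simp only [← add_assoc] at h₁' h₂'
  rw [add_comm N₂ N₁] at h₂'
  obtain ⟨f, hf, hsub⟩ := exists_image_schreier_add_subset hL hα hβ
  have h := (h₂'.famComp hε h₁').comp hf hsub
  rw [mul_comm]
  refine hγ.le_of_hasLowerEstimate hL (add_lt_omega_one hα hβ) ?_ (fun i => hy0 _)
    (mul_nonneg hε hδ) h
  exact isBlockBasis_comp y ((strictMono_const_add (N₁ + N₂)).comp hf)

theorem pow_le_mul {α : Ordinal.{0}} (hγ : DeltaStabilizes L y γ) (hL : IsLadderSystem L)
    (hα : α < ω₁) (hy0 : ∀ i, y i ≠ 0) (n j : ℕ) :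
    γ (α * n) ^ (j + 1) ≤ γ (α * (n * (j + 1) : ℕ)) := by
  induction j with
  | zero => simp
  | succ j ih =>
    have h1 := hγ.mul_le_add hL (mul_natCast_lt_omega_one hα (n * (j + 1)))
      (mul_natCast_lt_omega_one hα n) hy0
    rw [← mul_add, ← Nat.cast_add, show n * (j + 1) + n = n * (j + 1 + 1) by ring] at h1
    rw [pow_succ]
    exact (mul_le_mul_of_nonneg_right ih
      (hγ.nonneg hL (mul_natCast_lt_omega_one hα n) hy0)).trans h1

end DeltaStabilizes

/-! ### The constants `δ̈` -/

section

variable {E : Type*} [NormedAddCommGroup E] [NormedSpace ℝ E] {𝓕 : Set (Finset ℕ)}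

theorem IsEquivNorm.pos {p : Seminorm ℝ E} (hp : IsEquivNorm p) {v : E} (hv : v ≠ 0) : 0 < p v := by
  obtain ⟨c, C, hc, -, h⟩ := hp
  exact (mul_pos hc (norm_pos_iff.2 hv)).trans_le (h v).1

namespace IsBasisProjection

variable {y : ℕ → E} {Q : ℕ → E →L[ℝ] E} {K : ℝ}

theorem ne_zero_of_isBlockBasis (h : IsBasisProjection y Q K) {x : ℕ → E}
    (hx : IsBlockBasis x y) (i : ℕ) : x i ≠ 0 := by
  obtain ⟨Q', hQ'⟩ := h.exists_of_isBlockBasis hx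
  exact hQ'.ne_zero i

/-- The bound 1 makes the nested real suprema genuine. -/
theorem asympDelta_mem_upperBounds (h : IsBasisProjection y Q K) (h𝓕 : IsRegularFamily 𝓕)
    {p : Seminorm ℝ E} (hp : IsEquivNorm p) :
    1 ∈ upperBounds {r : ℝ | ∃ x : ℕ → E, IsBlockBasis x y ∧ r = asympDelta 𝓕 p x} := by
  rintro _ ⟨x, hx, rfl⟩
  exact asympDelta_le_one h𝓕 (hp.pos (h.ne_zero_of_isBlockBasis hx 0))

theorem dotDelta_mem_upperBounds (h : IsBasisProjection y Q K) (h𝓕 : IsRegularFamily 𝓕) :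
    1 ∈ upperBounds {r : ℝ | ∃ p : Seminorm ℝ E, IsEquivNorm p ∧ r = dotDelta 𝓕 p y} := by
  rintro _ ⟨p, hp, rfl⟩
  exact csSup_le ⟨_, y, IsBlockBasis.refl y, rfl⟩ (h.asympDelta_mem_upperBounds h𝓕 hp)

theorem asympDelta_le_ddotDelta (h : IsBasisProjection y Q K) (h𝓕 : IsRegularFamily 𝓕)
    {p : Seminorm ℝ E} (hp : IsEquivNorm p) {x : ℕ → E} (hx : IsBlockBasis x y) :
    asympDelta 𝓕 p x ≤ ddotDelta 𝓕 y :=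
  (le_csSup ⟨1, h.asympDelta_mem_upperBounds h𝓕 hp⟩ ⟨x, hx, rfl⟩).trans
    (le_csSup ⟨1, h.dotDelta_mem_upperBounds h𝓕⟩ ⟨p, hp, rfl⟩)

end IsBasisProjection

theorem isEquivNorm_normSeminorm : IsEquivNorm (normSeminorm ℝ E) :=
  ⟨1, 1, one_pos, one_pos, fun x => by simp⟩

theorem exists_lt_asympDelta_of_lt_ddotDelta {y : ℕ → E} {θ : ℝ} (hθ : θ < ddotDelta 𝓕 y) :
    ∃ p : Seminorm ℝ E, IsEquivNorm p ∧ ∃ x, IsBlockBasis x y ∧ θ < asympDelta 𝓕 p x := by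
  unfold ddotDelta at hθ
  obtain ⟨_, ⟨p, hp, rfl⟩, h1⟩ :=
    exists_lt_of_lt_csSup (by exact ⟨_, _, isEquivNorm_normSeminorm, rfl⟩) hθ
  unfold dotDelta at h1
  obtain ⟨_, ⟨x, hx, rfl⟩, h2⟩ :=
    exists_lt_of_lt_csSup (by exact ⟨_, _, IsBlockBasis.refl y, rfl⟩) h1
  exact ⟨p, hp, x, hx, h2⟩

theorem ddotDelta_nonneg {y : ℕ → E} : 0 ≤ ddotDelta 𝓕 y := by
  refine Real.sSup_nonneg ?_
  rintro _ ⟨p, -, rfl⟩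
  refine Real.sSup_nonneg ?_
  rintro _ ⟨x, -, rfl⟩
  exact asympDelta_nonneg

end

/-! ### The theorem -/

/-- A constant independent of the exponent disappears on taking roots. -/
theorem le_of_forall_pow_le_mul_pow {a b B : ℝ} (hb : 0 ≤ b)
    (h : ∀ j : ℕ, a ^ (j + 1) ≤ B * b ^ (j + 1)) : a ≤ b := by
  by_contra! hcon
  rcases hb.eq_or_lt with rfl | hb
  · have := h 0
    simp only [zero_add, pow_one, mul_zero] at this
    exact absurd this (not_le.2 hcon)
  · have h1 : 1 < a / b := (one_lt_div hb).2 hcon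
    obtain ⟨j, hj⟩ := pow_unbounded_of_one_lt B h1
    have h2 : (a / b) ^ (j + 1) ≤ B := by
      rw [div_pow, div_le_iff₀ (by positivity)]
      exact h j
    have h3 : (a / b) ^ j ≤ (a / b) ^ (j + 1) := pow_le_pow_right₀ h1.le (Nat.le_succ j)
    linarith

section

variable {X : Type*} [NormedAddCommGroup X] [NormedSpace ℝ X] {L : Ordinal.{0} → ℕ → Ordinal.{0}}
  {y : ℕ → X} {Q : ℕ → X →L[ℝ] X} {K : ℝ} {γ : Ordinal.{0} → ℝ} {α : Ordinal.{0}}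

theorem DeltaStabilizes.le_mul_ddotDelta_pow (hγ : DeltaStabilizes L y γ)
    (hL : IsLadderSystem L) (hy : IsBasisProjection y Q K) (hα : α < ω₁) (n : ℕ) :
    γ (α * n) ≤ K * (1 + K) * ddotDelta (schreier L α) (inClosedSpan y) ^ n := by
  have hK := hy.one_le
  have hB : 1 ≤ K * (1 + K) := by nlinarith
  have hd : 0 ≤ ddotDelta (schreier L α) (inClosedSpan y) := ddotDelta_nonneg
  rcases n with _ | n
  · rw [pow_zero, mul_one]
    exact (hγ.le_one hL (mul_natCast_lt_omega_one hα 0) hy.ne_zero).trans hB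
  refine le_of_forall_lt_imp_le_of_dense fun δ hδ => ?_
  rcases le_or_gt δ 0 with h0 | h0
  · exact h0.trans (by positivity)
  obtain ⟨Q', hQ'⟩ := hy.exists_inClosedSpan
  have hreg := isRegularFamily_schreier hL α hα
  obtain ⟨N, hN⟩ := hγ.exists_hasLowerEstimate hL (mul_natCast_lt_omega_one hα (n + 1)) hδ
  obtain ⟨f, hf, hsub⟩ := exists_image_famPow_subset hL hα (n + 1)
  have hg : StrictMono fun i => N + f i := (strictMono_const_add N).comp hf
  have hlow := (hasLowerEstimate_coe_iff (z := inClosedSpan y)).1 hN.of_tail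
  have hvar : HasBoundedVariation (fun k => Q' (N + f k)) (famPow (schreier L α) (n + 1))
      (K * (1 + K) / δ) := by
    refine hQ'.hasBoundedVariation mem_closure_range_blockVec_inClosedSpan hg h0 hlow
      fun F hF => ⟨F.image f, hsub F hF, ?_⟩
    exact Finset.image_image
  -- The largest θ for which θ^(n+1) times the variation bound `K * (1 + K) / δ` is at most 1.
  set θ : ℝ := (δ / (K * (1 + K))) ^ ((n + 1 : ℕ) : ℝ)⁻¹ with hθdef
  have hθ : 0 < θ := Real.rpow_pos_of_pos (by positivity) _
  have hθn : θ ^ (n + 1) = δ / (K * (1 + K)) :=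
    Real.rpow_inv_natCast_pow (by positivity) (Nat.succ_ne_zero n)
  obtain ⟨p, hp, hlow'⟩ := (hQ'.comp hg).exists_isEquivNorm_hasLowerEstimate hreg hθ
    (by rw [hθn]; field_simp; exact le_rfl) (by positivity) hvar
  have h1 : θ ≤ ddotDelta (schreier L α) (inClosedSpan y) :=
    (hlow'.le_asympDelta hreg (i := 0) (hp.pos (hQ'.ne_zero (N + f 0))) hθ.le).trans
      (hQ'.asympDelta_le_ddotDelta hreg hp (isBlockBasis_comp _ hg))
  have h2 := pow_le_pow_left₀ hθ.le h1 (n + 1)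
  rw [hθn, div_le_iff₀ (by positivity)] at h2
  linarith

theorem DeltaStabilizes.le_ddotDelta_pow (hγ : DeltaStabilizes L y γ)
    (hL : IsLadderSystem L) (hy : IsBasisProjection y Q K) (hα : α < ω₁) (n : ℕ) :
    γ (α * n) ≤ ddotDelta (schreier L α) (inClosedSpan y) ^ n := by
  refine le_of_forall_pow_le_mul_pow (B := K * (1 + K)) (pow_nonneg ddotDelta_nonneg n) fun j => ?_
  rw [← pow_mul]
  exact (hγ.pow_le_mul hL hα hy.ne_zero n j).trans (hγ.le_mul_ddotDelta_pow hL hy hα _)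

theorem DeltaStabilizes.asympDelta_pow_le (hγ : DeltaStabilizes L y γ)
    (hL : IsLadderSystem L) (hy : IsBasisProjection y Q K) (hα : α < ω₁) (n : ℕ) {D : ℝ}
    (hD : IsOfBoundedDistortion D (closedSpan y)) (hD1 : 1 ≤ D) {p : Seminorm ℝ (closedSpan y)}
    (hp : IsEquivNorm p) {x : ℕ → closedSpan y} (hx : IsBlockBasis x (inClosedSpan y)) :
    asympDelta (schreier L α) p x ^ n ≤ D * γ (α * n) := by
  have hlim : Tendsto (fun D' => D' * γ (α * n)) (𝓝[>] D) (𝓝 (D * γ (α * n))) :=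
    ((continuous_id.mul continuous_const).tendsto D).mono_left nhdsWithin_le_nhds
  refine ge_of_tendsto hlim (eventually_mem_nhdsWithin.mono fun D' hD' => ?_)
  have hD'0 : 0 < D' := (zero_lt_one.trans_le hD1).trans hD'
  obtain ⟨Q', hQ'⟩ := hy.exists_inClosedSpan
  obtain ⟨Qx, hQx⟩ := hQ'.exists_of_isBlockBasis hx
  have hreg := isRegularFamily_schreier hL α hα
  have hβ := mul_natCast_lt_omega_one hα n
  obtain ⟨f, hf, hsub⟩ := exists_image_schreier_mul_subset hL hα n
  have hpow := ((hasLowerEstimate_asympDelta (p := p) (x := x) hreg).famPow asympDelta_nonneg n).comp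
    hf hsub
  -- Distortion is applied after passing to the subsequence along `f`, so that the 𝓢_{α·n} estimate
  -- for `p` already holds and is inherited by `z`.
  obtain ⟨z, hz, hzp⟩ := hD.exists_isBlockBasis hD' hp (hQx.comp hf)
  have hδ : 0 ≤ asympDelta (schreier L α) p x ^ n := pow_nonneg asympDelta_nonneg n
  have hnorm := (hpow.of_isBlockBasis (isRegularFamily_schreier hL _ hβ) hz).norm_of_distortion
    hp hδ hD'0 hzp
  have hzy : IsBlockBasis z (inClosedSpan y) := (hz.trans (isBlockBasis_comp x hf)).trans hx
  have hzne := hQ'.ne_zero_of_isBlockBasis hzy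
  have h1 := hγ.le_of_hasLowerEstimate hL hβ hzy.coe (fun i h0 => hzne i (Subtype.ext h0))
    (mul_nonneg (inv_nonneg.2 hD'0.le) hδ) (hasLowerEstimate_coe_iff.2 hnorm)
  rwa [inv_mul_le_iff₀ hD'0] at h1

theorem DeltaStabilizes.ddotDelta_pow_le (hγ : DeltaStabilizes L y γ)
    (hL : IsLadderSystem L) (hy : IsBasisProjection y Q K) (hα : α < ω₁) (n : ℕ) {D : ℝ}
    (hD : IsOfBoundedDistortion D (closedSpan y)) (hD1 : 1 ≤ D) :
    ddotDelta (schreier L α) (inClosedSpan y) ^ n ≤ D * γ (α * n) := by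
  obtain ⟨Q', hQ'⟩ := hy.exists_inClosedSpan
  have hreg := isRegularFamily_schreier hL α hα
  -- When δ̈ is 0 there is no nonnegative θ below it to approximate with; the constant of `y` itself
  -- is then 0 and attains the supremum.
  rcases (ddotDelta_nonneg (𝓕 := schreier L α) (y := inClosedSpan y)).eq_or_lt with h0 | h0
  · have h1 := hQ'.asympDelta_le_ddotDelta hreg isEquivNorm_normSeminorm (IsBlockBasis.refl _)
    have h2 := hγ.asympDelta_pow_le hL hy hα n hD hD1 isEquivNorm_normSeminorm
      (IsBlockBasis.refl _)
    rw [← h0] at h1 ⊢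
    rwa [le_antisymm h1 asympDelta_nonneg] at h2
  · have hlim : Tendsto (fun θ : ℝ => θ ^ n)
        (𝓝[<] (ddotDelta (schreier L α) (inClosedSpan y)))
        (𝓝 (ddotDelta (schreier L α) (inClosedSpan y) ^ n)) :=
      ((continuous_pow n).tendsto _).mono_left nhdsWithin_le_nhds
    refine le_of_tendsto hlim (Filter.mem_of_superset (Ioo_mem_nhdsLT h0) fun θ hθ => ?_)
    obtain ⟨p, hp, x, hx, hlt⟩ := exists_lt_asympDelta_of_lt_ddotDelta hθ.2
    exact (pow_le_pow_left₀ hθ.1.le hlt.le n).trans (hγ.asympDelta_pow_le hL hy hα n hD hD1 hp hx)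

end
theorem theorem6p8 {X : Type*} [NormedAddCommGroup X] [NormedSpace ℝ X] [CompleteSpace X]
    (L : Ordinal.{0} → ℕ → Ordinal.{0}) (hL : IsLadderSystem L)
    (e : SchauderBasis ℝ X) (he : IsAsymptoticEllOne (e : ℕ → X))
    (y : ℕ → X) (hy : IsBlockBasis y (e : ℕ → X))
    (γ : Ordinal.{0} → ℝ) (hγ : DeltaStabilizes L y γ)
    (D : ℝ) (hD : IsOfBoundedDistortion D (closedSpan y))
    (α : Ordinal.{0}) (hα : α < ω₁) (n m : ℕ) :
    (D⁻¹ * ddotDelta (schreier L α) (inClosedSpan y) ^ n ≤ γ (α * n) ∧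
      γ (α * n) ≤ ddotDelta (schreier L α) (inClosedSpan y) ^ n) ∧
    (γ (α * n) * γ (α * m) ≤ γ (α * (n + m)) ∧
      γ (α * (n + m)) ≤ D ^ 2 * (γ (α * n) * γ (α * m))) := by

  obtain ⟨K, hK⟩ := e.exists_isBasisProjection
  obtain ⟨Q, hQ⟩ := hK.exists_of_isBlockBasis hy
  obtain ⟨Q', hQ'⟩ := hQ.exists_inClosedSpan
  have hD1 : 1 ≤ D := hD.one_le
    ⟨_, Submodule.isClosed_topologicalClosure _, hQ'.not_finiteDimensional_topologicalClosure⟩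
  have hD0 : 0 < D := zero_lt_one.trans_le hD1
  have hupper := hγ.le_ddotDelta_pow hL hQ hα
  have hlower := fun k => hγ.ddotDelta_pow_le hL hQ hα k hD hD1
  have hnonneg : ∀ k : ℕ, 0 ≤ γ (α * k) := fun k =>
    hγ.nonneg hL (mul_natCast_lt_omega_one hα k) hQ.ne_zero
  have hd : 0 ≤ ddotDelta (schreier L α) (inClosedSpan y) := ddotDelta_nonneg
  refine ⟨⟨?_, hupper n⟩, ?_, ?_⟩
  · rw [inv_mul_le_iff₀ hD0]
    exact hlower n
  · rw [mul_add]
    exact hγ.mul_le_add hL (mul_natCast_lt_omega_one hα n) (mul_natCast_lt_omega_one hα m)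
      hQ.ne_zero
  -- The power d^{n+m} splits exactly, and each of the two factors costs one `D`.
  · have h1 := hupper (n + m)
    rw [Nat.cast_add] at h1
    calc γ (α * (n + m)) ≤ ddotDelta (schreier L α) (inClosedSpan y) ^ (n + m) := h1
      _ = ddotDelta (schreier L α) (inClosedSpan y) ^ n *
          ddotDelta (schreier L α) (inClosedSpan y) ^ m := pow_add _ _ _
      _ ≤ (D * γ (α * n)) * (D * γ (α * m)) :=
          mul_le_mul (hlower n) (hlower m) (pow_nonneg hd m) (mul_nonneg hD0.le (hnonneg n))
      _ = D ^ 2 * (γ (α * n) * γ (α * m)) := by ring
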